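/- For a Lebesgue measurable set $A\subseteq\mathbb R^d$ let \[\delta^*(A)=\lim_{N\to\infty}\ \sup_{t\in\mathbb R^d}\frac{|A\cap(t+Q_N)|}{|Q_N|},\qquad Q_N=[-N/2,N/2]^d,\] denote its upper Banach density, where $|\cdot|$ is Lebesgue measure. For $\lambda>0$ and a finite set $S\subseteq\mathbb R^k$ with $k\le d$, an isometric copy of $\lambda\cdot S$ in $\mathbb R^d$ is a set of the form $z+\lambda\cdot U(S)$ with $z\in\mathbb R^d$ and $U\in SO(d)$, where $\mathbb R^k$ is identified with the subspace of $\mathbb R^d$ spanned by the first $k$ coordinate vectors. Let $\Box=\{0,v_1,v_2,v_1+v_2\}\subseteq\mathbb R^2$, where $v_1,v_2$ are nonzero and $v_1\cdot v_2=0$, be a fixed two-dimensional rectangle, let $d\ge 4$, and let $A\subseteq\mathbb R^d$ be a Lebesgue measurable set with $\delta^*(A)>0$. Then there is a threshold $\lambda_0=\lambda_0(A,\Box)>0$ such that for every $\lambda\ge\lambda_0$ the set $A$ contains an isometric copy of $\lambda\cdot\Box$. Moreover, for every $\lambda\ge\lambda_0$ and every splitting of coordinates $\mathbb R^d=\mathbb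 R^{d_1}\times\mathbb R^{d_2}$ with $d_1+d_2=d$ and $d_1,d_2\ge 2$, the set $A$ contains such an isometric copy of $\lambda\cdot\Box$ of the special form \[\{(x,y),(x',y),(x,y'),(x',y')\}\subseteq\mathbb R^{d_1}\times\mathbb R^{d_2},\qquad |x-x'|=\lambda|v_1|,\quad |y-y'|=\lambda|v_2|.\] -/

import Mathlib

open MeasureTheory Filter
open scoped ENNReal

noncomputable section

namespace RectBanach

/-- The closed axis-parallel cube `t + [-N/2, N/2]^d` in `ℝ^d`. -/
def cube {d : ℕ} (t : EuclideanSpace ℝ (Fin d)) (N : ℝ) : Set (EuclideanSpace ℝ (Fin d)) :=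
  {x | ∀ i, x i ∈ Set.Icc (t i - N / 2) (t i + N / 2)}

/-- The upper Banach density
`δ*(A) = lim_{N → ∞} sup_t |A ∩ (t + Q_N)| / |Q_N|`, with `Q_N = [-N/2, N/2]^d`.
It is written with `limsup` (over real `N`, in `[0, ∞]`), which is the limit whenever the
limit exists. -/
def upperBanachDensity {d : ℕ} (A : Set (EuclideanSpace ℝ (Fin d))) : ℝ≥0∞ :=
  limsup (fun N : ℝ => ⨆ t : EuclideanSpace ℝ (Fin d),
    volume (A ∩ cube t N) / volume (cube (0 : EuclideanSpace ℝ (Fin d)) N)) atTop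

/-- The four vertices `{0, v₁, v₂, v₁ + v₂}`. -/
def rectangle (v₁ v₂ : EuclideanSpace ℝ (Fin 2)) : Set (EuclideanSpace ℝ (Fin 2)) :=
  {0, v₁, v₂, v₁ + v₂}

/-- The standard inclusion `ℝ^k ⊆ ℝ^d` as the first `k` coordinates (used for `k ≤ d`). -/
def incl (k d : ℕ) (p : EuclideanSpace ℝ (Fin k)) : EuclideanSpace ℝ (Fin d) :=
  WithLp.toLp 2 fun i => if h : (i : ℕ) < k then p ⟨i, h⟩ else 0

/-- `S'` is an isometric copy of `lam · S` in `ℝ^d`: `S' = x + lam · U(S)` for some `x ∈ ℝ^d` and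
some rotation `U ∈ SO(d)`, where `S ⊆ ℝ^k` is regarded as a subset of `ℝ^d`. -/
def IsIsometricCopy {k d : ℕ} (lam : ℝ) (S : Set (EuclideanSpace ℝ (Fin k)))
    (S' : Set (EuclideanSpace ℝ (Fin d))) : Prop :=
  ∃ (x : EuclideanSpace ℝ (Fin d))
    (U : EuclideanSpace ℝ (Fin d) ≃ₗᵢ[ℝ] EuclideanSpace ℝ (Fin d)),
    LinearMap.det (U.toLinearEquiv : EuclideanSpace ℝ (Fin d) →ₗ[ℝ] EuclideanSpace ℝ (Fin d)) = 1 ∧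
    S' = (fun p => x + lam • U (incl k d p)) '' S

/-- The point `(x, y)` of `ℝ^{d₁} × ℝ^{d₂} = ℝ^d`, where `d₁ + d₂ = d`. -/
def pair {d₁ d₂ d : ℕ} (h : d₁ + d₂ = d) (x : EuclideanSpace ℝ (Fin d₁))
    (y : EuclideanSpace ℝ (Fin d₂)) : EuclideanSpace ℝ (Fin d) :=
  WithLp.toLp 2 fun i => Fin.append (fun j => x j) (fun j => y j) (Fin.cast h.symm i)

end RectBanach

end

/-!
Let `corr f u w` count the parallelograms with sides `u` and `w`, weighted by `f = 1_D`, where `D`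
is the part of `A` in a large cube. We want the average of `corr f` over `u` and `w` on two circles
of radius about `l` in orthogonal planes to be positive. Averaging instead over differences of
Gaussian vectors of size `l`, it is at least `θ |D|`, with `θ` depending only on the density of `A`,
by applying the Cauchy–Schwarz inequality twice.

As a function of one side, `corr f` is the autocorrelation of a function, hence the Fourier
transform of a positive measure by Plancherel's theorem, so that averages of it are controlled by
the characteristic functions of the averaging measures. That of the circle tends to zero at
infinity. Hence the circle average at scale `l` differs from the Gaussian one by at most
`ε |D| + K (G (l / 2) - G l)`, where `G s` is the Gaussian average at scale `s`, which decreases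
from at most `|D|`. If there were arbitrarily large bad scales, we could choose them lacunary; the
differences `G (l / 2) - G l` then telescope, so one of them is smaller than `c |D|`, for any given
`c > 0`, and at that scale the circle average is positive.
-/

noncomputable section

namespace RectBanach

section Plancherel

open FourierTransform SchwartzMap
open scoped RealInnerProductSpace

variable {V : Type*} [NormedAddCommGroup V] [InnerProductSpace ℝ V]

/-- The character `ξ ↦ exp (2πi ⟨u, ξ⟩)`, by which the Fourier transform turns the translation
`v ↦ v + u` into a multiplication. -/
def phase (u ξ : V) : ℂ := Real.fourierChar ⟪u, ξ⟫

lemma phase_eq_exp (u ξ : V) :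
    phase u ξ = Complex.exp (⟪(2 * Real.pi) • ξ, u⟫ * Complex.I) := by
  rw [phase, Real.fourierChar_apply, real_inner_smul_left, real_inner_comm]

lemma continuous_phase (u : V) : Continuous (phase u) := by
  simp only [funext (phase_eq_exp u)]
  fun_prop

lemma norm_phase (u ξ : V) : ‖phase u ξ‖ = 1 := Circle.norm_coe _

variable [FiniteDimensional ℝ V] [MeasurableSpace V] [BorelSpace V]

lemma memLp_phase (u : V) : MemLp (phase u) ∞ (volume : Measure V) :=
  memLp_top_of_bound (continuous_phase u).aestronglyMeasurable 1
    (Eventually.of_forall fun ξ => (norm_phase u ξ).le)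

lemma fourier_compSubConstCLM_neg (φ : 𝓢(V, ℂ)) (u ξ : V) :
    𝓕 (φ.compSubConstCLM ℂ (-u)) ξ = phase u ξ * 𝓕 φ ξ := by
  have hφ : ((φ.compSubConstCLM ℂ (-u) : 𝓢(V, ℂ)) : V → ℂ) = (φ : V → ℂ) ∘ fun v => v + u := by
    ext v; simp
  rw [SchwartzMap.fourier_coe, SchwartzMap.fourier_coe, hφ]
  exact congrFun (VectorFourier.fourierIntegral_comp_add_right Real.fourierChar
    (volume : Measure V) (innerₗ V) (φ : V → ℂ) u) ξ

/-- Translation `φ ↦ φ (· + u)` on square integrable functions. -/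
def translate (u : V) (φ : Lp (α := V) ℂ 2) : Lp (α := V) ℂ 2 :=
  Lp.compMeasurePreserving (· + u) (measurePreserving_add_right volume u) φ

lemma coeFn_translate (u : V) (φ : Lp (α := V) ℂ 2) :
    translate u φ =ᵐ[volume] fun v => φ (v + u) :=
  Lp.coeFn_compMeasurePreserving _ _

lemma translate_toLp (u : V) {f : V → ℂ} (hf : MemLp f 2 volume) :
    translate u (hf.toLp f) =ᵐ[volume] fun v => f (v + u) :=
  (coeFn_translate u _).trans
    ((measurePreserving_add_right volume u).quasiMeasurePreserving.ae hf.coeFn_toLp)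

lemma translate_schwartz_toLp (u : V) (φ : 𝓢(V, ℂ)) :
    translate u (φ.toLp 2) = (φ.compSubConstCLM ℂ (-u)).toLp 2 := by
  ext1
  filter_upwards [translate_toLp u (φ.memLp 2 volume),
    (φ.compSubConstCLM ℂ (-u)).coeFn_toLp 2 (volume : Measure V)] with v hv hv'
  rw [hv']
  exact hv.trans (by simp)

lemma fourier_translate (φ : Lp (α := V) ℂ 2) (u : V) :
    𝓕 (translate u φ) = ((memLp_phase u).toLp (phase u) • 𝓕 φ : Lp (α := V) ℂ 2) := by
  refine (SchwartzMap.denseRange_toLpCLM (p := 2) ENNReal.ofNat_ne_top).induction_on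
    (p := fun φ => 𝓕 (translate u φ) =
      ((memLp_phase u).toLp (phase u) • 𝓕 φ : Lp (α := V) ℂ 2)) φ (isClosed_eq ?_ ?_) fun φ => ?_
  · exact (Lp.fourierTransformₗᵢ V ℂ).continuous.comp
      (Lp.isometry_compMeasurePreserving _).continuous
  · exact ((ContinuousLinearMap.lsmul ℂ ℂ).holderL volume ∞ 2 2
      ((memLp_phase u).toLp (phase u))).continuous.comp (Lp.fourierTransformₗᵢ V ℂ).continuous
  · change 𝓕 (translate u (φ.toLp 2)) = (memLp_phase u).toLp (phase u) • 𝓕 (φ.toLp 2)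
    rw [translate_schwartz_toLp, SchwartzMap.toLp_fourier_eq, SchwartzMap.toLp_fourier_eq]
    ext1
    filter_upwards [(𝓕 (φ.compSubConstCLM ℂ (-u))).coeFn_toLp 2 (volume : Measure V),
      (𝓕 φ).coeFn_toLp 2 (volume : Measure V), (memLp_phase u).coeFn_toLp,
      Lp.coeFn_lpSMul (r := 2) ((memLp_phase u).toLp (phase u)) ((𝓕 φ).toLp 2 volume)]
      with ξ hleft hφ hphase hsmul
    rw [hsmul, Pi.smul_apply', hleft, hφ, hphase, fourier_compSubConstCLM_neg, smul_eq_mul]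

lemma inner_translate_eq_integral_phase (φ : Lp (α := V) ℂ 2) (u : V) :
    inner ℂ φ (translate u φ) = ∫ ξ, phase u ξ * ((‖(𝓕 φ : Lp (α := V) ℂ 2) ξ‖ ^ 2 : ℝ) : ℂ) := by
  rw [← Lp.inner_fourier_eq, fourier_translate, L2.inner_def]
  refine integral_congr_ae ?_
  filter_upwards [(memLp_phase u).coeFn_toLp,
    Lp.coeFn_lpSMul (r := 2) ((memLp_phase u).toLp (phase u)) (𝓕 φ)] with ξ hphase hsmul
  rw [hsmul, Pi.smul_apply', hphase, smul_eq_mul, RCLike.inner_apply, mul_assoc,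
    Complex.mul_conj, Complex.normSq_eq_norm_sq]

lemma inner_toLp_translate {g : V → ℝ} (hg : MemLp (fun v => (g v : ℂ)) 2 volume) (u : V) :
    inner ℂ hg.toLp (translate u hg.toLp) = ((∫ v, g v * g (v + u) : ℝ) : ℂ) := by
  rw [L2.inner_def, ← integral_complex_ofReal]
  refine integral_congr_ae ?_
  filter_upwards [hg.coeFn_toLp, translate_toLp u hg] with v hv hvu
  simp only [hv, hvu, RCLike.inner_apply, Complex.conj_ofReal, Complex.ofReal_mul]
  ring

lemma charFun_map_withDensity {ρ : V → ℝ} (hρ : Integrable ρ) (hρ0 : ∀ ξ, 0 ≤ ρ ξ) (u : V) :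
    charFun ((volume.withDensity fun ξ => ENNReal.ofReal (ρ ξ)).map ((2 * Real.pi) • ·)) u
      = ∫ ξ, phase u ξ * (ρ ξ : ℂ) := by
  rw [charFun_apply, integral_map (by fun_prop) (by fun_prop),
    integral_withDensity_eq_integral_toReal_smul₀ hρ.1.aemeasurable.ennreal_ofReal
      (Eventually.of_forall fun ξ => ENNReal.ofReal_lt_top)]
  congr 1 with ξ
  rw [ENNReal.toReal_ofReal (hρ0 ξ), phase_eq_exp, Complex.real_smul, mul_comm]

/-- A function is spectral if it is the Fourier transform of a finite measure; by Bochner's theorem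
these are, up to continuity, the positive definite functions. -/
def IsSpectral (c : V → ℝ) : Prop :=
  ∃ m : Measure V, IsFiniteMeasure m ∧ ∀ z, charFun m z = c z

theorem isSpectral_autocorrelation {g : V → ℝ} (hg : MemLp g 2 volume) :
    IsSpectral fun u => ∫ v, g v * g (v + u) := by
  have hgc : MemLp (fun v => (g v : ℂ)) 2 volume := hg.ofReal
  let ψ : Lp (α := V) ℂ 2 volume := 𝓕 hgc.toLp
  have hψ : Integrable (fun ξ => ‖ψ ξ‖ ^ 2) volume :=
    (memLp_two_iff_integrable_sq_norm (Lp.aestronglyMeasurable ψ)).1 (Lp.memLp ψ)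
  have : IsFiniteMeasure (volume.withDensity fun ξ => ENNReal.ofReal (‖ψ ξ‖ ^ 2)) :=
    isFiniteMeasure_withDensity_ofReal hψ.2
  refine ⟨(volume.withDensity fun ξ => ENNReal.ofReal (‖ψ ξ‖ ^ 2)).map ((2 * Real.pi) • ·),
    inferInstance, fun u => ?_⟩
  rw [charFun_map_withDensity hψ fun ξ => sq_nonneg _, ← inner_toLp_translate hgc,
    inner_translate_eq_integral_phase]

end Plancherel

section Transfer

open scoped RealInnerProductSpace

variable {V : Type*} [NormedAddCommGroup V] [InnerProductSpace ℝ V] [MeasurableSpace V]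

/-- `γ` and `γ'` have ordered Fourier transforms, and the Fourier transform of `σ` differs from
that of `γ` by at most `ε` plus `K` times their gap. In the application `γ` and `γ'` are Gaussians
at two comparable scales, so that the gap telescopes when it is summed over lacunary scales. -/
structure IsFourierClose (ε K : ℝ) (σ γ γ' : Measure V) : Prop where
  le : ∀ η, (charFun γ η).re ≤ (charFun γ' η).re
  abs_sub_le : ∀ η, |(charFun σ η).re - (charFun γ η).re| ≤
    ε + K * ((charFun γ' η).re - (charFun γ η).re)

/-- The average of a kernel over a pair of independent points with laws `μ` and `ν`. -/
def form (C : V → V → ℝ) (μ ν : Measure V) : ℝ := ∫ p, C p.1 p.2 ∂μ.prod ν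

/-- A symmetric kernel with values in `[0, M]` which is spectral in each variable separately. -/
structure IsSpectralKernel (C : V → V → ℝ) (M : ℝ) : Prop where
  measurable : Measurable fun p : V × V => C p.1 p.2
  nonneg : ∀ z w, 0 ≤ C z w
  le : ∀ z w, C z w ≤ M
  symm : ∀ z w, C z w = C w z
  isSpectral : ∀ w, IsSpectral fun z => C z w

namespace IsSpectralKernel

variable {C : V → V → ℝ} {M : ℝ}

lemma integrable (h : IsSpectralKernel C M) (P : Measure (V × V)) [IsFiniteMeasure P] :
    Integrable (fun p : V × V => C p.1 p.2) P :=
  (integrable_const M).mono' h.measurable.aestronglyMeasurable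
    (Eventually.of_forall fun _ => (Real.norm_of_nonneg (h.nonneg _ _)).trans_le (h.le _ _))

lemma form_comm (h : IsSpectralKernel C M) (μ ν : Measure V) [SFinite μ] [SFinite ν] :
    form C μ ν = form C ν μ := by
  rw [form, ← integral_prod_swap]
  exact integral_congr_ae (Eventually.of_forall fun p => h.symm _ _)

lemma form_nonneg (h : IsSpectralKernel C M) (μ ν : Measure V) : 0 ≤ form C μ ν :=
  integral_nonneg fun _ => h.nonneg _ _

lemma form_le (h : IsSpectralKernel C M) (μ ν : Measure V) [IsProbabilityMeasure μ]
    [IsProbabilityMeasure ν] : form C μ ν ≤ M :=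
  (integral_mono (h.integrable _) (integrable_const M) fun _ => h.le _ _).trans_eq (by simp)

lemma form_eq_integral_integral (h : IsSpectralKernel C M) (μ ν : Measure V) [IsFiniteMeasure μ]
    [IsFiniteMeasure ν] : form C μ ν = ∫ w, ∫ z, C z w ∂μ ∂ν :=
  integral_prod_symm _ (h.integrable _)

lemma integrable_integral (h : IsSpectralKernel C M) (μ ν : Measure V) [IsFiniteMeasure μ]
    [IsFiniteMeasure ν] : Integrable (fun w => ∫ z, C z w ∂μ) ν :=
  (h.integrable (μ.prod ν)).integral_prod_right

end IsSpectralKernel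

variable [BorelSpace V] [SecondCountableTopology V]

lemma integral_charFun_comm (m μ : Measure V) [IsFiniteMeasure m] [IsFiniteMeasure μ] :
    ∫ z, charFun m z ∂μ = ∫ η, charFun μ η ∂m := by
  simp only [charFun_apply]
  rw [integral_integral_swap]
  · simp only [real_inner_comm]
  · refine (integrable_const (1 : ℝ)).mono' (by fun_prop) (Eventually.of_forall fun p => ?_)
    exact (Complex.norm_exp_ofReal_mul_I _).le

lemma integrable_charFun (m μ : Measure V) [IsFiniteMeasure m] [IsFiniteMeasure μ] :
    Integrable (charFun m) μ :=
  (integrable_const (m.real Set.univ)).mono' continuous_charFun.aestronglyMeasurable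
    (Eventually.of_forall fun _ => norm_charFun_le _)

lemma IsSpectral.exists_integral_eq {c : V → ℝ} (hc : IsSpectral c) :
    ∃ m : Measure V, IsFiniteMeasure m ∧ m.real Set.univ = c 0 ∧
      ∀ (μ : Measure V) [IsFiniteMeasure μ], ∫ z, c z ∂μ = ∫ η, (charFun μ η).re ∂m := by
  obtain ⟨m, hm, hmc⟩ := hc
  refine ⟨m, hm, ?_, fun μ _ => ?_⟩
  · exact_mod_cast (charFun_zero m).symm.trans (hmc 0)
  · have hre : ∫ η, (charFun μ η).re ∂m = (∫ η, charFun μ η ∂m).re :=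
      integral_re (integrable_charFun μ m)
    rw [hre, ← integral_charFun_comm, integral_congr_ae (Eventually.of_forall hmc),
      integral_complex_ofReal, Complex.ofReal_re]

namespace IsSpectral

variable {c : V → ℝ} {σ γ γ' : Measure V} [IsFiniteMeasure σ] [IsFiniteMeasure γ]
  [IsFiniteMeasure γ']

protected lemma integral_mono (hc : IsSpectral c) (h : ∀ η, (charFun γ η).re ≤ (charFun γ' η).re) :
    ∫ z, c z ∂γ ≤ ∫ z, c z ∂γ' := by
  obtain ⟨m, _, -, hm⟩ := hc.exists_integral_eq
  rw [hm γ, hm γ']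
  exact integral_mono (integrable_charFun γ m).re (integrable_charFun γ' m).re h

lemma abs_integral_sub_le (hc : IsSpectral c) {ε K : ℝ} (h : IsFourierClose ε K σ γ γ') :
    |∫ z, c z ∂σ - ∫ z, c z ∂γ| ≤ ε * c 0 + K * (∫ z, c z ∂γ' - ∫ z, c z ∂γ) := by
  obtain ⟨m, _, hm0, hm⟩ := hc.exists_integral_eq
  have hre : ∀ μ : Measure V, [IsFiniteMeasure μ] → Integrable (fun η => (charFun μ η).re) m :=
    fun μ _ => (integrable_charFun μ m).re
  have hgap : Integrable (fun η => K * ((charFun γ' η).re - (charFun γ η).re)) m :=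
    ((hre γ').sub (hre γ)).const_mul K
  calc |∫ z, c z ∂σ - ∫ z, c z ∂γ|
      = ‖∫ η, ((charFun σ η).re - (charFun γ η).re) ∂m‖ := by
        rw [hm σ, hm γ, integral_sub (hre σ) (hre γ), Real.norm_eq_abs]
    _ ≤ ∫ η, (ε + K * ((charFun γ' η).re - (charFun γ η).re)) ∂m :=
        norm_integral_le_of_norm_le ((integrable_const ε).add hgap)
          (Eventually.of_forall h.abs_sub_le)
    _ = ε * c 0 + K * (∫ z, c z ∂γ' - ∫ z, c z ∂γ) := by
        rw [integral_add (integrable_const ε) hgap, integral_const_mul,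
          integral_sub (hre γ') (hre γ), hm γ, hm γ', integral_const, hm0, smul_eq_mul, mul_comm]

end IsSpectral

namespace IsSpectralKernel

variable {C : V → V → ℝ} {M : ℝ}

variable {σ γ γ' : Measure V} [IsProbabilityMeasure σ] [IsProbabilityMeasure γ]
  [IsProbabilityMeasure γ'] {ε K : ℝ}

lemma form_mono_left (h : IsSpectralKernel C M) (ν : Measure V) [IsFiniteMeasure ν]
    (hγ : ∀ η, (charFun γ η).re ≤ (charFun γ' η).re) : form C γ ν ≤ form C γ' ν := by
  rw [h.form_eq_integral_integral, h.form_eq_integral_integral]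
  exact integral_mono (h.integrable_integral γ ν) (h.integrable_integral γ' ν)
    fun w => (h.isSpectral w).integral_mono hγ

lemma form_mono_right (h : IsSpectralKernel C M) (ν : Measure V) [IsFiniteMeasure ν]
    (hγ : ∀ η, (charFun γ η).re ≤ (charFun γ' η).re) : form C ν γ ≤ form C ν γ' := by
  rw [h.form_comm ν, h.form_comm ν]
  exact h.form_mono_left ν hγ

lemma abs_form_sub_left_le (h : IsSpectralKernel C M) (ν : Measure V) [IsProbabilityMeasure ν]
    (hε : 0 ≤ ε) (hσ : IsFourierClose ε K σ γ γ') :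
    |form C σ ν - form C γ ν| ≤ ε * M + K * (form C γ' ν - form C γ ν) := by
  have hgap : Integrable (fun w => K * (∫ z, C z w ∂γ' - ∫ z, C z w ∂γ)) ν :=
    ((h.integrable_integral γ' ν).sub (h.integrable_integral γ ν)).const_mul K
  calc |form C σ ν - form C γ ν| = ‖∫ w, (∫ z, C z w ∂σ - ∫ z, C z w ∂γ) ∂ν‖ := by
        rw [integral_sub (h.integrable_integral σ ν) (h.integrable_integral γ ν),
          ← h.form_eq_integral_integral, ← h.form_eq_integral_integral, Real.norm_eq_abs]
    _ ≤ ∫ w, (ε * M + K * (∫ z, C z w ∂γ' - ∫ z, C z w ∂γ)) ∂ν := by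
        refine norm_integral_le_of_norm_le ((integrable_const _).add hgap)
          (Eventually.of_forall fun w => ((h.isSpectral w).abs_integral_sub_le hσ).trans ?_)
        gcongr
        exact h.le 0 w
    _ = ε * M + K * (form C γ' ν - form C γ ν) := by
        rw [integral_add (integrable_const _) hgap, integral_const_mul K,
          integral_sub (h.integrable_integral γ' ν) (h.integrable_integral γ ν),
          ← h.form_eq_integral_integral, ← h.form_eq_integral_integral]
        simp

lemma abs_form_sub_right_le (h : IsSpectralKernel C M) (ν : Measure V) [IsProbabilityMeasure ν]
    (hε : 0 ≤ ε) (hσ : IsFourierClose ε K σ γ γ') :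
    |form C ν σ - form C ν γ| ≤ ε * M + K * (form C ν γ' - form C ν γ) := by
  rw [h.form_comm ν σ, h.form_comm ν γ, h.form_comm ν γ']
  exact h.abs_form_sub_left_le ν hε hσ

lemma le_form_of_isFourierClose (h : IsSpectralKernel C M) {σ₁ γ₁ γ₁' σ₂ γ₂ γ₂' : Measure V}
    [IsProbabilityMeasure σ₁] [IsProbabilityMeasure γ₁] [IsProbabilityMeasure γ₁']
    [IsProbabilityMeasure σ₂] [IsProbabilityMeasure γ₂] [IsProbabilityMeasure γ₂']
    {ε₁ ε₂ K₁ K₂ : ℝ} (hε₁ : 0 ≤ ε₁) (hε₂ : 0 ≤ ε₂) (hK₁ : 0 ≤ K₁) (hK₂ : 0 ≤ K₂)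
    (hσ₁ : IsFourierClose ε₁ K₁ σ₁ γ₁ γ₁') (hσ₂ : IsFourierClose ε₂ K₂ σ₂ γ₂ γ₂') :
    form C γ₁ γ₂ - (ε₁ + ε₂ * (1 + 2 * K₁)) * M
        - (K₁ * (1 + 2 * K₂) + K₂) * (form C γ₁' γ₂' - form C γ₁ γ₂) ≤ form C σ₁ σ₂ := by
  -- Change one measure at a time; by monotonicity the mixed forms in the gaps lie between `F` and
  -- `F'`.
  set F := form C γ₁ γ₂
  set F' := form C γ₁' γ₂'
  have hleft := abs_le.1 (h.abs_form_sub_left_le σ₂ hε₁ hσ₁)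
  have hγ := abs_le.1 (h.abs_form_sub_right_le γ₁ hε₂ hσ₂)
  have hγ' := abs_le.1 (h.abs_form_sub_right_le γ₁' hε₂ hσ₂)
  have hlower : F - ε₂ * M - K₂ * (F' - F) ≤ form C γ₁ σ₂ := by
    have := mul_le_mul_of_nonneg_left (sub_le_sub_right (h.form_mono_left γ₂' hσ₁.le) F) hK₂
    linarith [hγ.1]
  have hupper : form C γ₁' σ₂ ≤ F' + ε₂ * M + K₂ * (F' - F) := by
    have hF : F ≤ form C γ₁' γ₂ := h.form_mono_left γ₂ hσ₁.le
    have hF' : form C γ₁' γ₂ ≤ F' := h.form_mono_right γ₁' hσ₂.le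
    have := mul_le_mul_of_nonneg_left (sub_le_sub_left hF F') hK₂
    linarith [hγ'.2]
  have hgap := mul_le_mul_of_nonneg_left (sub_le_sub hupper hlower) hK₁
  linarith [hleft.1]

end IsSpectralKernel

end Transfer

section Heat

open ProbabilityTheory Topology
open scoped RealInnerProductSpace

lemma exists_le_add_mul_of_tendsto_cocompact {X : Type*} [TopologicalSpace X] {h D : X → ℝ}
    (hh : Continuous h) (hD : Continuous D) (hD0 : ∀ x, 0 ≤ D x)
    (hlim : Tendsto h (cocompact X) (𝓝 0)) (hpos : ∀ x, 0 < h x → 0 < D x) {ε : ℝ} (hε : 0 < ε) :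
    ∃ K, 0 ≤ K ∧ ∀ x, h x ≤ ε + K * D x := by
  obtain ⟨t, ht, hsub⟩ := mem_cocompact.1 (hlim.eventually_lt_const hε)
  have hS : IsCompact {x | ε ≤ h x} :=
    ht.of_isClosed_subset (isClosed_le continuous_const hh) fun x hx =>
      by_contra fun hxt => (show h x < ε from hsub hxt).not_ge hx
  have hcont : ContinuousOn (fun x => h x / D x) {x | ε ≤ h x} :=
    hh.continuousOn.div hD.continuousOn fun x hx => (hpos x (hε.trans_le hx)).ne'
  obtain ⟨K, hK⟩ := hS.bddAbove_image hcont
  refine ⟨max K 0, le_max_right _ _, fun x => ?_⟩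
  rcases le_or_gt ε (h x) with hx | hx
  · have hDx := hpos x (hε.trans_le hx)
    calc h x ≤ K * D x := (div_le_iff₀ hDx).1 (hK ⟨x, hx, rfl⟩)
      _ ≤ max K 0 * D x := by gcongr; exact le_max_left _ _
      _ ≤ ε + max K 0 * D x := le_add_of_nonneg_left hε.le
  · exact hx.le.trans (le_add_of_nonneg_right (mul_nonneg (le_max_right _ _) (hD0 x)))

variable {E V : Type*} [NormedAddCommGroup E] [InnerProductSpace ℝ E] [FiniteDimensional ℝ E]
  [MeasurableSpace E] [BorelSpace E] [NormedAddCommGroup V] [InnerProductSpace ℝ V]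
  [FiniteDimensional ℝ V] [MeasurableSpace V] [BorelSpace V]

/-- The law of the difference of two independent points with law `μ`. -/
def selfDiff (μ : Measure V) : Measure V := (μ.prod μ).map fun p => p.1 - p.2

instance (μ : Measure V) [IsProbabilityMeasure μ] : IsProbabilityMeasure (selfDiff μ) :=
  Measure.isProbabilityMeasure_map (by fun_prop)

lemma charFun_selfDiff (μ : Measure V) [IsFiniteMeasure μ] (η : V) :
    charFun (selfDiff μ) η = charFun μ η * charFun μ (-η) := by
  rw [charFun_apply, selfDiff, integral_map (by fun_prop) (by fun_prop), charFun_apply,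
    charFun_apply, ← integral_prod_mul]
  congr 1 with p
  rw [← Complex.exp_add, inner_sub_left, inner_neg_right]
  push_cast
  ring_nf

lemma charFun_map_continuousLinearMap (μ : Measure E) (L : E →L[ℝ] V) (η : V) :
    charFun (μ.map L) η = charFun μ (L.adjoint η) := by
  rw [charFun_apply, integral_map (by fun_prop) (by fun_prop), charFun_apply]
  simp only [ContinuousLinearMap.adjoint_inner_right]

/-- The image under `L` of the law of the difference of two independent standard Gaussian vectors;
its averages replace those over the image under `L` of a sphere. -/
def heat (L : E →L[ℝ] V) : Measure V := selfDiff ((stdGaussian E).map L)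

instance (L : E →L[ℝ] V) : IsProbabilityMeasure ((stdGaussian E).map L) :=
  Measure.isProbabilityMeasure_map (by fun_prop)

instance (L : E →L[ℝ] V) : IsProbabilityMeasure (heat L) :=
  inferInstanceAs (IsProbabilityMeasure (selfDiff _))

lemma re_charFun_heat (L : E →L[ℝ] V) (η : V) :
    (charFun (heat L) η).re = Real.exp (-‖L.adjoint η‖ ^ 2) := by
  have h : charFun (heat L) η = (Real.exp (-‖L.adjoint η‖ ^ 2) : ℂ) := by
    rw [heat, charFun_selfDiff, charFun_map_continuousLinearMap, charFun_map_continuousLinearMap,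
      map_neg, charFun_stdGaussian, charFun_stdGaussian, norm_neg, ← Complex.exp_add]
    push_cast
    ring_nf
  rw [h, Complex.ofReal_re]

lemma re_charFun_heat_smul_le {s t : ℝ} (hs : 0 ≤ s) (hst : s ≤ t) (L : E →L[ℝ] V) (η : V) :
    (charFun (heat (t • L)) η).re ≤ (charFun (heat (s • L)) η).re := by
  simp only [re_charFun_heat, map_smulₛₗ, smul_apply, norm_smul,
    RCLike.conj_to_real, Real.norm_of_nonneg hs, Real.norm_of_nonneg (hs.trans hst)]
  gcongr

lemma exists_isFourierClose_heat {σ : Measure E} [IsProbabilityMeasure σ]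
    (hσ : Tendsto (charFun σ) (cocompact E) (𝓝 0)) {ε : ℝ} (hε : 0 < ε) :
    ∃ K, 0 ≤ K ∧ ∀ L : E →L[ℝ] V,
      IsFourierClose ε K (σ.map L) (heat L) (heat ((2⁻¹ : ℝ) • L)) := by
  have hre : Tendsto (fun η => (charFun σ η).re) (cocompact E) (𝓝 0) :=
    Complex.zero_re ▸ (Complex.continuous_re.tendsto 0).comp hσ
  have hexp : Tendsto (fun η : E => Real.exp (-‖η‖ ^ 2)) (cocompact E) (𝓝 0) := by
    have hsq : Tendsto (fun η : E => ‖η‖ ^ 2) (cocompact E) atTop :=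
      (tendsto_pow_atTop two_ne_zero).comp (tendsto_norm_cocompact_atTop (E := E))
    exact Real.tendsto_exp_atBot.comp (tendsto_neg_atTop_atBot.comp hsq)
  have hlim : Tendsto (fun η => |(charFun σ η).re - Real.exp (-‖η‖ ^ 2)|) (cocompact E) (𝓝 0) := by
    simpa using (hre.sub hexp).abs
  have hhalf : ∀ η : E, ‖(2⁻¹ : ℝ) • η‖ = ‖η‖ / 2 := fun η => by
    rw [norm_smul, Real.norm_of_nonneg (by norm_num), inv_mul_eq_div]
  have hgap : ∀ η : E, 0 ≤ Real.exp (-‖(2⁻¹ : ℝ) • η‖ ^ 2) - Real.exp (-‖η‖ ^ 2) := fun η => by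
    rw [hhalf, sub_nonneg, Real.exp_le_exp]
    nlinarith [sq_nonneg ‖η‖]
  have hgap_pos : ∀ η, 0 < |(charFun σ η).re - Real.exp (-‖η‖ ^ 2)| →
      0 < Real.exp (-‖(2⁻¹ : ℝ) • η‖ ^ 2) - Real.exp (-‖η‖ ^ 2) := fun η hη => by
    have hη0 : η ≠ 0 := by rintro rfl; simp at hη
    rw [hhalf, sub_pos, Real.exp_lt_exp]
    nlinarith [pow_pos (norm_pos_iff.2 hη0) 2]
  obtain ⟨K, hK, hle⟩ := exists_le_add_mul_of_tendsto_cocompact (by fun_prop) (by fun_prop)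
    hgap hlim hgap_pos hε
  refine ⟨K, hK, fun L => ⟨fun η => ?_, fun η => ?_⟩⟩
  · simpa using re_charFun_heat_smul_le (by norm_num) (by norm_num : (2⁻¹ : ℝ) ≤ 1) L η
  · simp only [re_charFun_heat, charFun_map_continuousLinearMap, map_smulₛₗ, smul_apply,
      RCLike.conj_to_real]
    exact hle (L.adjoint η)

end Heat

section Circle

open ProbabilityTheory Topology
open scoped RealInnerProductSpace

theorem tendsto_charFun_cocompact_of_absolutelyContinuous {V : Type*} [NormedAddCommGroup V]
    [InnerProductSpace ℝ V] [FiniteDimensional ℝ V] [MeasurableSpace V] [BorelSpace V]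
    {μ : Measure V} [IsFiniteMeasure μ] (hμ : μ ≪ volume) :
    Tendsto (charFun μ) (cocompact V) (𝓝 0) := by
  have hscale : Tendsto (fun η : V => (-(2 * Real.pi)⁻¹) • η) (cocompact V) (cocompact V) :=
    (Homeomorph.smulOfNeZero (-(2 * Real.pi)⁻¹)
      (by simp [Real.pi_ne_zero])).isClosedEmbedding.tendsto_cocompact
  refine ((tendsto_integral_exp_inner_smul_cocompact fun v =>
    ((μ.rnDeriv volume v).toReal : ℂ)).comp hscale).congr fun η => ?_
  rw [charFun_apply, ← integral_rnDeriv_smul hμ]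
  refine integral_congr_ae (Eventually.of_forall fun v => ?_)
  simp only [Circle.smul_def, Real.fourierChar_apply, inner_smul_right, smul_eq_mul,
    Complex.real_smul]
  rw [mul_comm, show 2 * Real.pi * -(-(2 * Real.pi)⁻¹ * ⟪v, η⟫) = ⟪v, η⟫ by field_simp]

/-- The uniform probability measure on an interval of angles representing a full turn. -/
def angleLaw : Measure ℝ := volume[|Set.Ioc (-Real.pi) Real.pi]

instance : IsProbabilityMeasure angleLaw :=
  cond_isProbabilityMeasure_of_finite (by simp [Real.pi_pos]) (by simp)

/-- The uniform probability measure on the unit circle. -/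
def circleLaw : Measure ℂ := angleLaw.map (circleMap 0 1)

instance : IsProbabilityMeasure circleLaw := Measure.isProbabilityMeasure_map (by fun_prop)

lemma ae_norm_eq_one_circleLaw : ∀ᵐ z ∂circleLaw, z ∈ {z : ℂ | ‖z‖ = 1} :=
  (ae_map_iff (by fun_prop) (isClosed_eq continuous_norm continuous_const).measurableSet).2
    (Eventually.of_forall fun θ => by simp)

lemma map_cos_angleLaw_absolutelyContinuous : angleLaw.map Real.cos ≪ volume := by
  refine Measure.AbsolutelyContinuous.mk fun s hs hs0 => ?_
  -- `Real.arccos` is differentiable only inside `(-1, 1)`, so the angles `0` and `π` are set aside.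
  let A := Real.arccos '' (s ∩ Set.Ioo (-1) 1)
  have hA : volume A = 0 :=
    addHaar_image_eq_zero_of_differentiableOn_of_addHaar_eq_zero volume
      (fun x hx => (Real.differentiableAt_arccos.2
        ⟨hx.2.1.ne', hx.2.2.ne⟩).differentiableWithinAt)
      (measure_mono_null Set.inter_subset_left hs0)
  have hsub : Set.Ioc (-Real.pi) Real.pi ∩ Real.cos ⁻¹' s ⊆ A ∪ -A ∪ {0, Real.pi} := by
    rintro θ ⟨⟨hθ, hθ'⟩, hθs⟩
    have habs : |θ| = Real.arccos (Real.cos θ) := by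
      rw [← Real.cos_abs, Real.arccos_cos (abs_nonneg θ) (abs_le.2 ⟨hθ.le, hθ'⟩)]
    by_cases hcos : Real.cos θ ∈ Set.Ioo (-1) 1
    · refine Or.inl ((abs_choice θ).imp (fun h => ?_) fun h => Set.mem_neg.2 ?_) <;>
        exact ⟨Real.cos θ, ⟨hθs, hcos⟩, by rw [← habs, h]⟩
    · rw [Set.mem_Ioo, not_and_or, not_lt, not_lt] at hcos
      rcases hcos with h | h
      · rw [(Real.neg_one_le_cos θ).antisymm' h, Real.arccos_neg_one] at habs
        exact Or.inr (Or.inr (((abs_eq Real.pi_pos.le).1 habs).resolve_right hθ.ne'))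
      · rw [(Real.cos_le_one θ).antisymm h, Real.arccos_one] at habs
        exact Or.inr (Or.inl (abs_eq_zero.1 habs))
  rw [Measure.map_apply Real.continuous_cos.measurable hs, angleLaw, cond_apply measurableSet_Ioc]
  refine mul_eq_zero_of_right _ (measure_mono_null hsub ?_)
  exact measure_union_null (measure_union_null hA ((Measure.measure_neg volume A).trans hA))
    ((Set.toFinite _).measure_zero _)

lemma inner_circleMap (θ : ℝ) (η : ℂ) : ⟪circleMap 0 1 θ, η⟫ = Real.cos (θ - η.arg) * ‖η‖ := by
  rw [Complex.inner, Real.cos_sub, add_mul, mul_assoc, mul_assoc, mul_comm (Real.cos η.arg),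
    mul_comm (Real.sin η.arg), Complex.norm_mul_cos_arg, Complex.norm_mul_sin_arg]
  simp [circleMap, Complex.exp_ofReal_mul_I_re, Complex.exp_ofReal_mul_I_im]
  ring

lemma integral_angleLaw_comp_sub {f : ℝ → ℂ} (hf : Function.Periodic f (2 * Real.pi)) (a : ℝ) :
    ∫ θ, f (θ - a) ∂angleLaw = ∫ θ, f θ ∂angleLaw := by
  have hturn : ∫ θ in -Real.pi..Real.pi, f (θ - a) = ∫ θ in -Real.pi..Real.pi, f θ := by
    rw [intervalIntegral.integral_comp_sub_right]
    convert hf.intervalIntegral_add_eq (-Real.pi - a) (-Real.pi) using 2 <;> ring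
  rw [intervalIntegral.integral_of_le (by linarith [Real.pi_pos]),
    intervalIntegral.integral_of_le (by linarith [Real.pi_pos])] at hturn
  rw [angleLaw, ProbabilityTheory.cond, integral_smul_measure, integral_smul_measure, hturn]

lemma charFun_circleLaw (η : ℂ) :
    charFun circleLaw η = charFun (angleLaw.map Real.cos) ‖η‖ := by
  rw [charFun_apply, circleLaw, integral_map (by fun_prop) (by fun_prop), charFun_apply,
    integral_map (by fun_prop) (by fun_prop)]
  simp only [inner_circleMap]
  refine (integral_angleLaw_comp_sub (f := fun θ =>
    Complex.exp ((Real.cos θ * ‖η‖ : ℝ) * Complex.I)) (fun θ => ?_) _).trans ?_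
  · simp only [Real.cos_periodic θ]
  · simp [mul_comm]

theorem tendsto_charFun_circleLaw : Tendsto (charFun circleLaw) (cocompact ℂ) (𝓝 0) := by
  simp only [funext charFun_circleLaw]
  exact (tendsto_charFun_cocompact_of_absolutelyContinuous
    map_cos_angleLaw_absolutelyContinuous).comp
      (tendsto_norm_cocompact_atTop.mono_right atTop_le_cocompact)

end Circle

section BoxInequality

lemma pow_succ_integral_le {α : Type*} [MeasurableSpace α] {μ : Measure α} [IsFiniteMeasure μ]
    {g : α → ℝ} {n : ℕ} (hg0 : ∀ x, 0 ≤ g x) (hg : Integrable g μ)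
    (hgn : Integrable (fun x => g x ^ (n + 1)) μ) :
    (∫ x, g x ∂μ) ^ (n + 1) ≤ μ.real Set.univ ^ n * ∫ x, g x ^ (n + 1) ∂μ := by
  rcases eq_or_ne μ 0 with rfl | hμ
  · simp
  have : NeZero μ := ⟨hμ⟩
  have hpos : 0 < μ.real Set.univ := measureReal_univ_pos
  have h := (convexOn_pow (𝕜 := ℝ) (n + 1)).map_average_le (continuous_pow _).continuousOn
    isClosed_Ici (Eventually.of_forall hg0) hg hgn
  simp only [average_eq, smul_eq_mul, mul_pow, inv_pow] at h
  rwa [inv_mul_le_iff₀ (by positivity), pow_succ (μ.real _), mul_assoc,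
    mul_inv_cancel_left₀ hpos.ne'] at h

lemma integral_mem_Icc_zero_one {α : Type*} [MeasurableSpace α] {μ : Measure α}
    [IsProbabilityMeasure μ] {g : α → ℝ} (hg : ∀ x, g x ∈ Set.Icc 0 1) :
    ∫ x, g x ∂μ ∈ Set.Icc 0 1 :=
  ⟨integral_nonneg fun x => (hg x).1, by
    simpa using integral_mono_of_nonneg (μ := μ) (Eventually.of_forall fun x => (hg x).1)
      (integrable_const 1) (Eventually.of_forall fun x => (hg x).2)⟩

variable {X Y : Type*}

/-- The product of the values of `h` at the four corners of the box with sides `r.1` and `r.2`. -/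
def boxProd (h : X → Y → ℝ) (r : (X × X) × Y × Y) : ℝ :=
  h r.1.1 r.2.1 * h r.1.2 r.2.1 * (h r.1.1 r.2.2 * h r.1.2 r.2.2)

variable [MeasurableSpace X] [MeasurableSpace Y] (μ : Measure X) (ν : Measure Y)
  [IsProbabilityMeasure μ] [IsProbabilityMeasure ν] {h : X → Y → ℝ}

lemma sq_integral_prod_le (hm : Measurable (Function.uncurry h))
    (h01 : ∀ x y, h x y ∈ Set.Icc 0 1) :
    (∫ p, h p.1 p.2 ∂μ.prod ν) ^ 2 ≤
      ∫ r : (X × X) × Y, h r.1.1 r.2 * h r.1.2 r.2 ∂(μ.prod μ).prod ν := by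
  have hslice : ∀ y, ∫ x, h x y ∂μ ∈ Set.Icc 0 1 := fun y =>
    integral_mem_Icc_zero_one fun x => h01 x y
  have hslice_meas : Measurable fun y => ∫ x, h x y ∂μ :=
    (hm.comp measurable_swap).stronglyMeasurable.integral_prod_right'.measurable
  have hint : Integrable (fun p : X × Y => h p.1 p.2) (μ.prod ν) :=
    .of_mem_Icc 0 1 hm.aemeasurable (Eventually.of_forall fun _ => h01 _ _)
  have hpair : Integrable (fun r : (X × X) × Y => h r.1.1 r.2 * h r.1.2 r.2)
      ((μ.prod μ).prod ν) :=
    .of_mem_Icc 0 1 (by fun_prop)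
      (Eventually.of_forall fun _ => unitInterval.mul_mem (h01 _ _) (h01 _ _))
  have hjensen := pow_succ_integral_le (μ := ν) (n := 1) (fun y => (hslice y).1)
    (.of_mem_Icc 0 1 hslice_meas.aemeasurable (Eventually.of_forall hslice))
    (.of_mem_Icc 0 1 (hslice_meas.pow_const _).aemeasurable
      (Eventually.of_forall fun y => ⟨pow_nonneg (hslice y).1 _,
        pow_le_one₀ (hslice y).1 (hslice y).2⟩))
  rw [integral_prod_symm _ hint, integral_prod_symm _ hpair]
  refine hjensen.trans_eq ?_
  simp only [probReal_univ, one_pow, one_mul, Nat.reduceAdd, sq]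
  exact integral_congr_ae (Eventually.of_forall fun y =>
    (integral_prod_mul (fun x => h x y) fun x => h x y).symm)

theorem box_inequality (hm : Measurable (Function.uncurry h))
    (h01 : ∀ x y, h x y ∈ Set.Icc 0 1) :
    (∫ p, h p.1 p.2 ∂μ.prod ν) ^ 4 ≤ ∫ r, boxProd h r ∂(μ.prod μ).prod (ν.prod ν) := by
  calc (∫ p, h p.1 p.2 ∂μ.prod ν) ^ 4 = ((∫ p, h p.1 p.2 ∂μ.prod ν) ^ 2) ^ 2 := by ring
    _ ≤ (∫ r : (X × X) × Y, h r.1.1 r.2 * h r.1.2 r.2 ∂(μ.prod μ).prod ν) ^ 2 :=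
      pow_le_pow_left₀ (sq_nonneg _) (sq_integral_prod_le μ ν hm h01) 2
    _ = (∫ r : Y × X × X, h r.2.1 r.1 * h r.2.2 r.1 ∂ν.prod (μ.prod μ)) ^ 2 := by
      rw [← integral_prod_swap]
      rfl
    _ ≤ ∫ r : (Y × Y) × X × X, h r.2.1 r.1.1 * h r.2.2 r.1.1 * (h r.2.1 r.1.2 * h r.2.2 r.1.2)
          ∂(ν.prod ν).prod (μ.prod μ) :=
      sq_integral_prod_le ν (μ.prod μ) (h := fun y a => h a.1 y * h a.2 y)
        (by unfold Function.uncurry at *; fun_prop)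
        fun _ _ => unitInterval.mul_mem (h01 _ _) (h01 _ _)
    _ = ∫ r, boxProd h r ∂(μ.prod μ).prod (ν.prod ν) := by
      rw [← integral_prod_swap]
      rfl

end BoxInequality

section Correlation

variable {V : Type*} [NormedAddCommGroup V] [InnerProductSpace ℝ V] [FiniteDimensional ℝ V]
  [MeasurableSpace V] [BorelSpace V]

/-- The count of parallelograms with sides `u` and `w`, weighted by `f`. Its integrand is grouped so
as to be an autocorrelation in `u`. -/
def corr (f : V → ℝ) (u w : V) : ℝ := ∫ v, f v * f (v + w) * (f (v + u) * f (v + u + w))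

lemma corr_comm (f : V → ℝ) (u w : V) : corr f u w = corr f w u := by
  unfold corr
  congr 1 with v
  rw [add_right_comm]
  ring

variable {f : V → ℝ} (hf : Measurable f) (hi : Integrable f) (h01 : ∀ v, f v ∈ Set.Icc 0 1)

include hf hi h01

lemma isSpectral_corr (w : V) : IsSpectral fun u => corr f u w := by
  have hg01 : ∀ v, f v * f (v + w) ∈ Set.Icc 0 1 := fun v => unitInterval.mul_mem (h01 _) (h01 _)
  refine isSpectral_autocorrelation (g := fun v => f v * f (v + w))
    ((memLp_two_iff_integrable_sq (by fun_prop)).2 (hi.mono' (by fun_prop) ?_))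
  refine Eventually.of_forall fun v => ?_
  rw [Real.norm_of_nonneg (sq_nonneg _)]
  calc (f v * f (v + w)) ^ 2 ≤ f v * f (v + w) :=
        pow_le_of_le_one (hg01 v).1 (hg01 v).2 two_ne_zero
    _ ≤ f v := mul_le_of_le_one_right (h01 v).1 (h01 _).2

theorem isSpectralKernel_corr : IsSpectralKernel (corr f) (∫ v, f v) where
  measurable := by
    have : Measurable fun q : (V × V) × V => f q.2 * f (q.2 + q.1.2) *
      (f (q.2 + q.1.1) * f (q.2 + q.1.1 + q.1.2)) := by fun_prop
    exact this.stronglyMeasurable.integral_prod_right'.measurable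
  nonneg u w := integral_nonneg fun v => (unitInterval.mul_mem
    (unitInterval.mul_mem (h01 _) (h01 _)) (unitInterval.mul_mem (h01 _) (h01 _))).1
  le u w := by
    have hrest : ∀ v, f (v + w) * (f (v + u) * f (v + u + w)) ∈ Set.Icc 0 1 := fun v =>
      unitInterval.mul_mem (h01 _) (unitInterval.mul_mem (h01 _) (h01 _))
    simp only [corr, mul_assoc]
    exact integral_mono_of_nonneg
      (Eventually.of_forall fun v => mul_nonneg (h01 v).1 (hrest v).1) hi
      (Eventually.of_forall fun v => mul_le_of_le_one_right (h01 v).1 (hrest v).2)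
  symm := corr_comm f
  isSpectral := isSpectral_corr hf hi h01

omit h01 in
lemma integrable_comp_add_prod {Ω : Type*} [MeasurableSpace Ω] (P : Measure Ω)
    [IsFiniteMeasure P] {τ : Ω → V} (hτ : Measurable τ) :
    Integrable (fun r : V × Ω => f (r.1 + τ r.2)) (volume.prod P) := by
  refine (integrable_prod_iff' (hf.comp (by fun_prop)).aestronglyMeasurable).2
    ⟨Eventually.of_forall fun ω => hi.comp_add_right (τ ω), ?_⟩
  exact (integrable_const (∫ v, ‖f v‖)).congr (Eventually.of_forall fun ω =>
    (integral_add_right_eq_self (fun v => ‖f v‖) (τ ω)).symm)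

lemma integrable_boxProd (P : Measure ((V × V) × V × V)) [IsFiniteMeasure P] :
    Integrable (fun q : V × (V × V) × V × V => boxProd (fun a b => f (q.1 + (a + b))) q.2)
      (volume.prod P) := by
  refine (integrable_comp_add_prod hf hi P
    (τ := fun r => r.1.1 + r.2.1) (by fun_prop)).mono' ?_ (Eventually.of_forall fun q => ?_)
  · unfold boxProd
    fun_prop
  · have hrest := unitInterval.mul_mem (h01 (q.1 + (q.2.1.2 + q.2.2.1)))
      (unitInterval.mul_mem (h01 (q.1 + (q.2.1.1 + q.2.2.2))) (h01 (q.1 + (q.2.1.2 + q.2.2.2))))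
    rw [boxProd, mul_assoc, Real.norm_of_nonneg (mul_nonneg (h01 _).1 hrest.1)]
    exact mul_le_of_le_one_right (h01 _).1 hrest.2

omit hf hi h01 in
lemma corr_sub_sub (r : (V × V) × V × V) : corr f (r.1.1 - r.1.2) (r.2.1 - r.2.2) =
    ∫ v, boxProd (fun a b => f (v + (a + b))) r := by
  rw [corr, ← integral_add_right_eq_self _ (r.1.2 + r.2.2)]
  congr 1 with v
  rw [boxProd, show v + (r.1.2 + r.2.2) + (r.2.1 - r.2.2) = v + (r.1.2 + r.2.1) by abel,
    show v + (r.1.2 + r.2.2) + (r.1.1 - r.1.2) = v + (r.1.1 + r.2.2) by abel,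
    show v + (r.1.1 + r.2.2) + (r.2.1 - r.2.2) = v + (r.1.1 + r.2.1) by abel]
  ring

variable (μ ν : Measure V) [IsProbabilityMeasure μ] [IsProbabilityMeasure ν]

lemma form_corr_selfDiff : form (corr f) (selfDiff μ) (selfDiff ν) =
    ∫ v, ∫ r, boxProd (fun a b => f (v + (a + b))) r ∂(μ.prod μ).prod (ν.prod ν) := by
  rw [integral_integral_swap (integrable_boxProd hf hi h01 _), form, selfDiff, selfDiff,
    Measure.map_prod_map _ _ (by fun_prop) (by fun_prop), integral_map (by fun_prop)
      (isSpectralKernel_corr hf hi h01).measurable.aestronglyMeasurable]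
  simp only [Prod.map_fst, Prod.map_snd, corr_sub_sub]

lemma integral_pow_four_le_form_corr_selfDiff {B : Set V} (hB : volume B ≠ ∞) :
    (∫ v in B, ∫ p, f (v + (p.1 + p.2)) ∂μ.prod ν) ^ 4 ≤
      volume.real B ^ 3 * form (corr f) (selfDiff μ) (selfDiff ν) := by
  have : IsFiniteMeasure (volume.restrict B) := ⟨by simpa using hB.lt_top⟩
  have hmeas : Measurable fun v => ∫ p, f (v + (p.1 + p.2)) ∂μ.prod ν := by
    have : Measurable fun q : V × V × V => f (q.1 + (q.2.1 + q.2.2)) := by fun_prop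
    exact this.stronglyMeasurable.integral_prod_right'.measurable
  have hmem : ∀ v, ∫ p, f (v + (p.1 + p.2)) ∂μ.prod ν ∈ Set.Icc 0 1 := fun v =>
    integral_mem_Icc_zero_one fun _ => h01 _
  have hbox : ∀ v, (∫ p, f (v + (p.1 + p.2)) ∂μ.prod ν) ^ 4 ≤
      ∫ r, boxProd (fun a b => f (v + (a + b))) r ∂(μ.prod μ).prod (ν.prod ν) := fun v =>
    box_inequality μ ν (h := fun a b => f (v + (a + b))) (hf.comp (by fun_prop))
      fun _ _ => h01 _
  have hint := (integrable_boxProd hf hi h01 ((μ.prod μ).prod (ν.prod ν))).integral_prod_left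
  have hpow := pow_succ_integral_le (μ := volume.restrict B) (n := 3) (fun v => (hmem v).1)
    (.of_mem_Icc 0 1 hmeas.aemeasurable (Eventually.of_forall hmem))
    (.of_mem_Icc 0 1 (hmeas.pow_const _).aemeasurable (Eventually.of_forall fun v =>
      ⟨pow_nonneg (hmem v).1 _, pow_le_one₀ (hmem v).1 (hmem v).2⟩))
  rw [measureReal_restrict_apply_univ] at hpow
  refine hpow.trans ?_
  rw [form_corr_selfDiff hf hi h01]
  gcongr
  refine (integral_mono_of_nonneg (Eventually.of_forall fun v => pow_nonneg (hmem v).1 _)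
    hint.integrableOn (Eventually.of_forall hbox)).trans ?_
  exact setIntegral_le_integral hint
    (Eventually.of_forall fun v => (pow_nonneg (hmem v).1 4).trans (hbox v))

omit h01 in
lemma integral_half_le_setIntegral (h0 : ∀ v, 0 ≤ f v) {B : Set V} {Γ : Set (V × V)}
    (hΓ : MeasurableSet Γ) (hΓ2 : 1 / 2 ≤ (μ.prod ν).real Γ)
    (hΓB : ∀ p ∈ Γ, ∀ v, f (v + (p.1 + p.2)) ≠ 0 → v ∈ B) :
    (∫ v, f v) / 2 ≤ ∫ v in B, ∫ p, f (v + (p.1 + p.2)) ∂μ.prod ν := by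
  have hint : Integrable (fun r : V × V × V => f (r.1 + (r.2.1 + r.2.2)))
      ((volume.restrict B).prod (μ.prod ν)) :=
    (integrable_comp_add_prod hf hi (μ.prod ν) (τ := fun p => p.1 + p.2) (by fun_prop)).mono_measure
      (Measure.prod_mono Measure.restrict_le_self le_rfl)
  have hinner : ∀ p ∈ Γ, ∫ v in B, f (v + (p.1 + p.2)) = ∫ v, f v := fun p hp => by
    rw [setIntegral_eq_integral_of_forall_compl_eq_zero fun v hv => not_imp_comm.1 (hΓB p hp v) hv]
    exact integral_add_right_eq_self f _
  calc (∫ v, f v) / 2 ≤ (μ.prod ν).real Γ * ∫ v, f v := by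
        linarith [mul_le_mul_of_nonneg_right hΓ2 (integral_nonneg (μ := volume) h0)]
    _ = ∫ p in Γ, (∫ v in B, f (v + (p.1 + p.2))) ∂μ.prod ν := by
        rw [setIntegral_congr_fun hΓ hinner, setIntegral_const, smul_eq_mul]
    _ ≤ ∫ p, (∫ v in B, f (v + (p.1 + p.2))) ∂μ.prod ν :=
        setIntegral_le_integral hint.integral_prod_right
          (Eventually.of_forall fun p => integral_nonneg fun v => h0 _)
    _ = ∫ v in B, ∫ p, f (v + (p.1 + p.2)) ∂μ.prod ν := (integral_integral_swap hint).symm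

end Correlation

section Scales

lemma exists_lacunary_of_frequently {p : ℝ → Prop} (h : ∃ᶠ x in atTop, p x) :
    ∃ l : ℕ → ℝ, (∀ j, 0 < l j ∧ p (l j)) ∧ ∀ j, l j ≤ 2⁻¹ * l (j + 1) := by
  obtain ⟨l, hl, hlac⟩ := exists_seq_of_forall_finset_exists (fun x => 0 < x ∧ p x)
    (fun x y => x ≤ 2⁻¹ * y) fun s _ => by
      obtain ⟨y, hpy, hy0, hy⟩ := (h.and_eventually ((eventually_gt_atTop 0).and
        ((Finset.eventually_all s).2 fun x _ => eventually_ge_atTop (2 * x)))).exists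
      exact ⟨y, ⟨hy0, hpy⟩, fun x hx => by linarith [hy x hx]⟩
  exact ⟨l, hl, fun j => hlac j (j + 1) j.lt_succ_self⟩

lemma exists_lt_mul_sub_le_of_antitoneOn {F : ℝ → ℝ} {M : ℝ} (hF : AntitoneOn F (Set.Ici 0))
    (hFM : ∀ s, F s ∈ Set.Icc 0 M) {l : ℕ → ℝ} (hl0 : ∀ j, 0 < l j)
    (hl : ∀ j, l j ≤ 2⁻¹ * l (j + 1)) {J : ℕ} (hJ : 0 < J) :
    ∃ j < J, J * (F (2⁻¹ * l j) - F (l j)) ≤ M := by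
  have hsum : ∑ j ∈ Finset.range J, (F (2⁻¹ * l j) - F (l j)) ≤
      ∑ _j ∈ Finset.range J, M / J := by
    calc ∑ j ∈ Finset.range J, (F (2⁻¹ * l j) - F (l j))
        ≤ ∑ j ∈ Finset.range J, (F (2⁻¹ * l j) - F (2⁻¹ * l (j + 1))) := by
          gcongr with j
          exact hF (hl0 j).le ((hl0 j).le.trans (hl j)) (hl j)
      _ = F (2⁻¹ * l 0) - F (2⁻¹ * l J) :=
          Finset.sum_range_sub' (fun j => F (2⁻¹ * l j)) J
      _ ≤ M := by linarith [(hFM (2⁻¹ * l 0)).2, (hFM (2⁻¹ * l J)).1]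
      _ = ∑ _j ∈ Finset.range J, M / J := by
          rw [Finset.sum_const, Finset.card_range, nsmul_eq_mul, mul_div_cancel₀]
          exact_mod_cast hJ.ne'
  obtain ⟨j, hj, hle⟩ := Finset.exists_le_of_sum_le (by simpa using hJ.ne') hsum
  rw [le_div_iff₀' (by exact_mod_cast hJ)] at hle
  exact ⟨j, Finset.mem_range.1 hj, hle⟩

end Scales

section Density

variable {d : ℕ}

lemma indicator_one_mem_Icc {α : Type*} (s : Set α) (x : α) :
    s.indicator (1 : α → ℝ) x ∈ Set.Icc 0 1 :=
  ⟨Set.indicator_nonneg (fun _ _ => zero_le_one) x,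
    Set.indicator_le_self' (fun _ _ => zero_le_one) x⟩

lemma integrable_indicator_one {α : Type*} [MeasurableSpace α] {μ : Measure α} {s : Set α}
    (hs : MeasurableSet s) (hμs : μ s ≠ ∞) : Integrable (s.indicator (1 : α → ℝ)) μ :=
  (integrable_indicator_iff hs).2 (integrableOn_const hμs)

lemma cube_eq_preimage (t : EuclideanSpace ℝ (Fin d)) (N : ℝ) :
    cube t N = (WithLp.ofLp : EuclideanSpace ℝ (Fin d) → Fin d → ℝ) ⁻¹'
      Set.Icc (fun i => t i - N / 2) (fun i => t i + N / 2) := by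
  ext x
  simp only [cube, Set.mem_Icc, Pi.le_def, Set.mem_preimage, Set.mem_ofPred, forall_and]

lemma measurableSet_cube (t : EuclideanSpace ℝ (Fin d)) (N : ℝ) : MeasurableSet (cube t N) := by
  rw [cube_eq_preimage]
  exact (PiLp.volume_preserving_ofLp (Fin d)).measurable measurableSet_Icc

lemma volume_cube (t : EuclideanSpace ℝ (Fin d)) (N : ℝ) :
    volume (cube t N) = ENNReal.ofReal N ^ d := by
  rw [cube_eq_preimage, (PiLp.volume_preserving_ofLp (Fin d)).measure_preimage
    measurableSet_Icc.nullMeasurableSet, Real.volume_Icc_pi]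
  simp only [add_sub_sub_cancel, add_halves, Finset.prod_const, Finset.card_univ,
    Fintype.card_fin]

lemma volume_cube_ne_top (t : EuclideanSpace ℝ (Fin d)) (N : ℝ) : volume (cube t N) ≠ ∞ := by
  simp [volume_cube]

lemma volume_real_cube (t : EuclideanSpace ℝ (Fin d)) {N : ℝ} (hN : 0 ≤ N) :
    volume.real (cube t N) = N ^ d := by
  rw [measureReal_def, volume_cube, ENNReal.toReal_pow, ENNReal.toReal_ofReal hN]

lemma frequently_exists_mul_pow_le {A : Set (EuclideanSpace ℝ (Fin d))}
    (hpos : 0 < upperBanachDensity A) :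
    ∃ η : ℝ, 0 < η ∧ ∃ᶠ N in atTop, ∃ t, η * N ^ d ≤ volume.real (A ∩ cube t N) := by
  obtain ⟨δ, hδ0, hδ⟩ := exists_between hpos
  refine ⟨δ.toReal, ENNReal.toReal_pos hδ0.ne' hδ.ne_top, ?_⟩
  refine ((frequently_lt_of_lt_limsup (by isBoundedDefault) hδ).and_eventually
    (eventually_gt_atTop 0)).mono fun N ⟨hN, hN0⟩ => ?_
  obtain ⟨t, ht⟩ := lt_iSup_iff.1 hN
  have hne : volume (cube t N) ≠ 0 := by simpa [volume_cube] using fun h => absurd h hN0.not_ge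
  rw [show volume (cube 0 N) = volume (cube t N) by simp only [volume_cube]] at ht
  have hle : δ * volume (cube t N) ≤ volume (A ∩ cube t N) :=
    ((ENNReal.lt_div_iff_mul_lt (.inl hne) (.inl (volume_cube_ne_top t N))).1 ht).le
  refine ⟨t, ?_⟩
  rw [← volume_real_cube t hN0.le, measureReal_def, measureReal_def, ← ENNReal.toReal_mul]
  exact ENNReal.toReal_mono (measure_ne_top_of_subset Set.inter_subset_right
    (volume_cube_ne_top t N)) hle

lemma eventually_half_le_measure_norm_le {Ω V : Type*} [MeasurableSpace Ω] [Norm V]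
    (P : Measure Ω) [IsProbabilityMeasure P] (τ : Ω → V) :
    ∀ᶠ R : ℝ in atTop, 1 / 2 ≤ P.real {ω | ‖τ ω‖ ≤ R} := by
  have hmono : Monotone fun R : ℝ => {ω | ‖τ ω‖ ≤ R} := fun _ _ h _ hω => le_trans hω h
  have hlim := tendsto_measure_iUnion_atTop (μ := P) hmono
  rw [Set.eq_univ_of_forall fun ω => Set.mem_iUnion.2 ⟨‖τ ω‖, le_refl ‖τ ω‖⟩,
    measure_univ] at hlim
  exact (((ENNReal.tendsto_toReal ENNReal.one_ne_top).comp hlim).eventually_const_lt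
    (u := 1 / 2) (by norm_num)).mono fun R => le_of_lt

lemma mem_cube_two_mul {t v x : EuclideanSpace ℝ (Fin d)} {N : ℝ} (hvx : v + x ∈ cube t N)
    (hx : ‖x‖ ≤ N / 2) : v ∈ cube t (2 * N) := fun i => by
  have hvxi := hvx i
  have hxi := abs_le.1 ((PiLp.norm_apply_le x i).trans hx)
  rw [PiLp.add_apply] at hvxi
  constructor <;> linarith [hvxi.1, hvxi.2, hxi.1, hxi.2]

lemma half_pow_four_le_form_corr_indicator {D : Set (EuclideanSpace ℝ (Fin d))}
    (hD : MeasurableSet D) {t : EuclideanSpace ℝ (Fin d)} {N : ℝ} (hN : 0 ≤ N)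
    (hDt : D ⊆ cube t N) (μ ν : Measure (EuclideanSpace ℝ (Fin d))) [IsProbabilityMeasure μ]
    [IsProbabilityMeasure ν] (hμν : 1 / 2 ≤ (μ.prod ν).real {p | ‖p.1 + p.2‖ ≤ N / 2}) :
    (volume.real D / 2) ^ 4 ≤
      ((2 * N) ^ d) ^ 3 * form (corr (D.indicator 1)) (selfDiff μ) (selfDiff ν) := by
  have hDfin : volume D ≠ ∞ := measure_ne_top_of_subset hDt (volume_cube_ne_top t N)
  have hhalf := integral_half_le_setIntegral (measurable_one.indicator hD)
    (integrable_indicator_one hD hDfin) μ ν (fun v => (indicator_one_mem_Icc D v).1)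
    (B := cube t (2 * N)) (measurableSet_le (by fun_prop) measurable_const) hμν
    fun p hp v hv => mem_cube_two_mul (hDt (Set.mem_of_indicator_ne_zero hv)) hp
  rw [integral_indicator_one hD] at hhalf
  calc (volume.real D / 2) ^ 4 ≤ _ := by gcongr
    _ ≤ _ := integral_pow_four_le_form_corr_selfDiff (measurable_one.indicator hD)
        (integrable_indicator_one hD hDfin) (indicator_one_mem_Icc D) μ ν
        (volume_cube_ne_top t (2 * N))
    _ = _ := by rw [volume_real_cube t (by positivity)]

lemma le_form_corr_indicator {D : Set (EuclideanSpace ℝ (Fin d))} (hD : MeasurableSet D)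
    {t : EuclideanSpace ℝ (Fin d)} {N η : ℝ} (hN : 0 < N) (hη : 0 < η) (hDt : D ⊆ cube t N)
    (hDη : η * N ^ d ≤ volume.real D) (μ ν : Measure (EuclideanSpace ℝ (Fin d)))
    [IsProbabilityMeasure μ] [IsProbabilityMeasure ν]
    (hμν : 1 / 2 ≤ (μ.prod ν).real {p | ‖p.1 + p.2‖ ≤ N / 2}) :
    η ^ 3 / (16 * 8 ^ d) * volume.real D ≤
      form (corr (D.indicator 1)) (selfDiff μ) (selfDiff ν) := by
  have hDpos : 0 < volume.real D := lt_of_lt_of_le (by positivity) hDη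
  have hform := half_pow_four_le_form_corr_indicator hD hN.le hDt μ ν hμν
  rw [← div_le_iff₀' (by positivity)] at hform
  refine le_trans ?_ hform
  rw [le_div_iff₀ (by positivity)]
  calc η ^ 3 / (16 * 8 ^ d) * volume.real D * ((2 * N) ^ d) ^ 3
      = volume.real D / 16 * (η * N ^ d) ^ 3 := by
        rw [mul_pow 2, mul_pow, ← pow_mul, mul_comm d 3, pow_mul]
        field_simp
        norm_num
    _ ≤ volume.real D / 16 * volume.real D ^ 3 := by gcongr
    _ = (volume.real D / 2) ^ 4 := by ring

theorem exists_forall_le_form_corr_indicator {A : Set (EuclideanSpace ℝ (Fin d))}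
    (hA : NullMeasurableSet A volume) (hpos : 0 < upperBanachDensity A) :
    ∃ θ : ℝ, 0 < θ ∧ ∀ {ι : Type} (s : Finset ι) (μ ν : ι → Measure (EuclideanSpace ℝ (Fin d)))
      [∀ i, IsProbabilityMeasure (μ i)] [∀ i, IsProbabilityMeasure (ν i)],
      ∃ D ⊆ A, MeasurableSet D ∧ volume D ≠ ∞ ∧ 0 < volume.real D ∧ ∀ i ∈ s,
        θ * volume.real D ≤ form (corr (D.indicator 1)) (selfDiff (μ i)) (selfDiff (ν i)) := by
  obtain ⟨A', hA'A, hA'm, hA'ae⟩ := hA.exists_measurable_subset_ae_eq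
  obtain ⟨η, hη, hfreq⟩ := frequently_exists_mul_pow_le hpos
  refine ⟨η ^ 3 / (16 * 8 ^ d), by positivity, fun s μ ν _ _ => ?_⟩
  have htight : ∀ᶠ N : ℝ in atTop, ∀ i ∈ s,
      1 / 2 ≤ ((μ i).prod (ν i)).real {p | ‖p.1 + p.2‖ ≤ N / 2} :=
    (Finset.eventually_all s).2 fun i _ => (tendsto_id.atTop_div_const two_pos).eventually
      (eventually_half_le_measure_norm_le ((μ i).prod (ν i)) fun p => p.1 + p.2)
  obtain ⟨N, ⟨t, ht⟩, hN, hN0⟩ :=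
    (hfreq.and_eventually (htight.and (eventually_gt_atTop 0))).exists
  have hD : MeasurableSet (A' ∩ cube t N) := hA'm.inter (measurableSet_cube t N)
  rw [← measureReal_congr (hA'ae.inter (ae_eq_refl (cube t N)))] at ht
  exact ⟨A' ∩ cube t N, Set.inter_subset_left.trans hA'A, hD,
    measure_ne_top_of_subset Set.inter_subset_right (volume_cube_ne_top t N),
    lt_of_lt_of_le (by positivity) ht, fun i hi =>
      le_form_corr_indicator hD hN0 hη Set.inter_subset_right ht (μ i) (ν i) (hN i hi)⟩

end Density

section Parallelograms

open ProbabilityTheory Topology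

variable {V : Type*} [NormedAddCommGroup V] [InnerProductSpace ℝ V] [FiniteDimensional ℝ V]
  [MeasurableSpace V] [BorelSpace V] {D : Set V}

lemma isSpectralKernel_corr_indicator (hD : MeasurableSet D) (hDfin : volume D ≠ ∞) :
    IsSpectralKernel (corr (D.indicator 1)) (volume.real D) := by
  rw [← integral_indicator_one hD]
  exact isSpectralKernel_corr (measurable_one.indicator hD) (integrable_indicator_one hD hDfin)
    (indicator_one_mem_Icc D)

variable {E F : Type*} [NormedAddCommGroup E] [InnerProductSpace ℝ E] [FiniteDimensional ℝ E]
  [MeasurableSpace E] [BorelSpace E] [NormedAddCommGroup F] [InnerProductSpace ℝ F]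
  [FiniteDimensional ℝ F] [MeasurableSpace F] [BorelSpace F]

lemma exists_parallelogram_of_form_corr_pos (hD : MeasurableSet D) (hDfin : volume D ≠ ∞)
    {σ₁ : Measure E} {σ₂ : Measure F} [IsFiniteMeasure σ₁] [IsFiniteMeasure σ₂]
    {S₁ : Set E} {S₂ : Set F} (hS₁ : ∀ᵐ z ∂σ₁, z ∈ S₁) (hS₂ : ∀ᵐ w ∂σ₂, w ∈ S₂)
    {L₁ : E →L[ℝ] V} {L₂ : F →L[ℝ] V}
    (hpos : 0 < form (corr (D.indicator 1)) (σ₁.map L₁) (σ₂.map L₂)) :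
    ∃ v, ∃ z ∈ S₁, ∃ w ∈ S₂, v ∈ D ∧ v + L₁ z ∈ D ∧ v + L₂ w ∈ D ∧ v + L₁ z + L₂ w ∈ D := by
  contrapose! hpos
  rw [form, Measure.map_prod_map _ _ (by fun_prop) (by fun_prop), integral_map (by fun_prop)
    (isSpectralKernel_corr_indicator hD hDfin).measurable.aestronglyMeasurable]
  refine (integral_eq_zero_of_ae ?_).le
  filter_upwards [Measure.quasiMeasurePreserving_fst.ae hS₁,
    Measure.quasiMeasurePreserving_snd.ae hS₂] with p hp₁ hp₂
  refine integral_eq_zero_of_ae (Eventually.of_forall fun v => ?_)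
  by_contra hne
  simp only [Pi.zero_apply, mul_eq_zero, not_or] at hne
  exact hpos v p.1 hp₁ p.2 hp₂ (Set.mem_of_indicator_ne_zero hne.1.1)
    (Set.mem_of_indicator_ne_zero hne.2.1) (Set.mem_of_indicator_ne_zero hne.1.2)
    (Set.mem_of_indicator_ne_zero hne.2.2)

lemma IsSpectralKernel.antitoneOn_form_heat_smul {C : V → V → ℝ} {M : ℝ}
    (h : IsSpectralKernel C M) (L₁ : E →L[ℝ] V) (L₂ : F →L[ℝ] V) :
    AntitoneOn (fun s : ℝ => form C (heat (s • L₁)) (heat (s • L₂))) (Set.Ici 0) :=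
  fun _ hs _ _ hst =>
    (h.form_mono_left _ (re_charFun_heat_smul_le hs hst L₁)).trans
      (h.form_mono_right _ (re_charFun_heat_smul_le hs hst L₂))

lemma exists_le_form_map {σ₁ : Measure E} {σ₂ : Measure F} [IsProbabilityMeasure σ₁]
    [IsProbabilityMeasure σ₂] (hσ₁ : Tendsto (charFun σ₁) (cocompact E) (𝓝 0))
    (hσ₂ : Tendsto (charFun σ₂) (cocompact F) (𝓝 0)) {ε : ℝ} (hε : 0 < ε) :
    ∃ K, 0 ≤ K ∧ ∀ (C : V → V → ℝ) (M : ℝ), IsSpectralKernel C M →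
      ∀ (L₁ : E →L[ℝ] V) (L₂ : F →L[ℝ] V),
        form C (heat L₁) (heat L₂) - ε * M - K * (form C (heat ((2⁻¹ : ℝ) • L₁))
          (heat ((2⁻¹ : ℝ) • L₂)) - form C (heat L₁) (heat L₂)) ≤
            form C (σ₁.map L₁) (σ₂.map L₂) := by
  obtain ⟨K₁, hK₁, hclose₁⟩ := exists_isFourierClose_heat (V := V) hσ₁ (half_pos hε)
  obtain ⟨K₂, hK₂, hclose₂⟩ := exists_isFourierClose_heat (V := V) hσ₂
    (ε := ε / 2 / (1 + 2 * K₁)) (by positivity)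
  refine ⟨K₁ * (1 + 2 * K₂) + K₂, by positivity, fun C M hC L₁ L₂ => ?_⟩
  have : IsProbabilityMeasure (σ₁.map L₁) := Measure.isProbabilityMeasure_map (by fun_prop)
  have : IsProbabilityMeasure (σ₂.map L₂) := Measure.isProbabilityMeasure_map (by fun_prop)
  have hle := hC.le_form_of_isFourierClose (by positivity) (by positivity) hK₁ hK₂
    (hclose₁ L₁) (hclose₂ L₂)
  rwa [div_mul_cancel₀ _ (by positivity), add_halves] at hle

theorem eventually_exists_parallelogram {d : ℕ} {A : Set (EuclideanSpace ℝ (Fin d))}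
    (hA : NullMeasurableSet A volume) (hpos : 0 < upperBanachDensity A)
    {σ₁ : Measure E} {σ₂ : Measure F} [IsProbabilityMeasure σ₁] [IsProbabilityMeasure σ₂]
    (hσ₁ : Tendsto (charFun σ₁) (cocompact E) (𝓝 0))
    (hσ₂ : Tendsto (charFun σ₂) (cocompact F) (𝓝 0))
    {S₁ : Set E} {S₂ : Set F} (hS₁ : ∀ᵐ z ∂σ₁, z ∈ S₁) (hS₂ : ∀ᵐ w ∂σ₂, w ∈ S₂)
    (L₁ : E →L[ℝ] EuclideanSpace ℝ (Fin d)) (L₂ : F →L[ℝ] EuclideanSpace ℝ (Fin d)) :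
    ∀ᶠ l : ℝ in atTop, ∃ v, ∃ z ∈ S₁, ∃ w ∈ S₂,
      v ∈ A ∧ v + l • L₁ z ∈ A ∧ v + l • L₂ w ∈ A ∧ v + l • L₁ z + l • L₂ w ∈ A := by
  by_contra hbad
  obtain ⟨l, hl, hlac⟩ := exists_lacunary_of_frequently (not_eventually.1 hbad)
  obtain ⟨θ, hθ, hdense⟩ := exists_forall_le_form_corr_indicator hA hpos
  obtain ⟨K, hK, htransfer⟩ := exists_le_form_map (V := EuclideanSpace ℝ (Fin d)) hσ₁ hσ₂
    (half_pos hθ)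
  obtain ⟨J, hJ⟩ := exists_nat_gt (K / (θ / 2))
  have hJ0 : 0 < J := by exact_mod_cast (by positivity : 0 ≤ K / (θ / 2)).trans_lt hJ
  obtain ⟨D, hDA, hD, hDfin, hD0, hlow⟩ := hdense (Finset.range J)
    (fun j => (stdGaussian E).map (l j • L₁)) fun j => (stdGaussian F).map (l j • L₂)
  have hC := isSpectralKernel_corr_indicator hD hDfin
  obtain ⟨j, hj, hdrop⟩ := exists_lt_mul_sub_le_of_antitoneOn
    (hC.antitoneOn_form_heat_smul L₁ L₂) (fun s => ⟨hC.form_nonneg _ _, hC.form_le _ _⟩)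
    (fun j => (hl j).1) hlac hJ0
  have hle := htransfer _ _ hC (l j • L₁) (l j • L₂)
  have hfar : θ * volume.real D ≤
      form (corr (D.indicator 1)) (heat (l j • L₁)) (heat (l j • L₂)) :=
    hlow j (Finset.mem_range.2 hj)
  simp only [smul_smul] at hle
  have hsmall : K * (form (corr (D.indicator 1)) (heat ((2⁻¹ * l j) • L₁))
      (heat ((2⁻¹ * l j) • L₂)) - form (corr (D.indicator 1)) (heat (l j • L₁))
        (heat (l j • L₂))) < θ / 2 * volume.real D := by
    rw [div_lt_iff₀ (half_pos hθ)] at hJ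
    refine lt_of_mul_lt_mul_left ?_ (Nat.cast_nonneg (α := ℝ) J)
    nlinarith [mul_le_mul_of_nonneg_left hdrop hK, mul_lt_mul_of_pos_right hJ hD0]
  obtain ⟨v, z, hz, w, hw, h₀, h₁, h₂, h₁₂⟩ :=
    exists_parallelogram_of_form_corr_pos hD hDfin hS₁ hS₂ (by linarith)
  exact (hl j).2 ⟨v, z, hz, w, hw, hDA h₀, hDA h₁, hDA h₂, hDA h₁₂⟩

end Parallelograms

section Rotations

variable {E : Type*} [NormedAddCommGroup E] [InnerProductSpace ℝ E]

lemma orthonormal_normalize_pair {p q : E} (hp : p ≠ 0) (hq : q ≠ 0) (hpq : inner ℝ p q = 0) :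
    Orthonormal ℝ ![‖p‖⁻¹ • p, ‖q‖⁻¹ • q] := by
  simp [orthonormal_vecCons_iff, norm_smul, hp, hq, inner_smul_left, inner_smul_right, hpq]

variable [FiniteDimensional ℝ E]

lemma det_linearIsometryEquiv_eq_one_or_neg_one (U : E ≃ₗᵢ[ℝ] E) :
    LinearMap.det (U.toLinearEquiv : E →ₗ[ℝ] E) = 1 ∨
      LinearMap.det (U.toLinearEquiv : E →ₗ[ℝ] E) = -1 := by
  have h := U.toLinearIsometry.normDet_eq_one
  rw [LinearMap.normDet_eq_abs_det] at h
  exact (abs_eq zero_le_one).1 h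

lemma det_reflection_orthogonal_span_singleton {x : E} (hx : x ≠ 0) :
    LinearMap.det ((ℝ ∙ x)ᗮ.reflection.toLinearEquiv : E →ₗ[ℝ] E) = -1 := by
  have h : LinearMap.det ((ℝ ∙ x)ᗮ.reflection.toLinearEquiv : E →ₗ[ℝ] E) =
      (-1) ^ Module.finrank ℝ (ℝ ∙ x)ᗮᗮ := (ℝ ∙ x)ᗮ.det_reflection
  rw [h, Submodule.orthogonal_orthogonal, finrank_span_singleton hx, pow_one]

lemma exists_det_eq_one_eqOn (U : E ≃ₗᵢ[ℝ] E) {K : Submodule ℝ E} (hK : K ≠ ⊤) :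
    ∃ V : E ≃ₗᵢ[ℝ] E, LinearMap.det (V.toLinearEquiv : E →ₗ[ℝ] E) = 1 ∧ Set.EqOn V U K := by
  obtain hdet | hdet := det_linearIsometryEquiv_eq_one_or_neg_one U
  · exact ⟨U, hdet, fun _ _ => rfl⟩
  obtain ⟨x, hxK, hx⟩ := Kᗮ.exists_mem_ne_zero_of_ne_bot
    (mt (Submodule.orthogonal_eq_bot_iff).1 hK)
  refine ⟨(ℝ ∙ x)ᗮ.reflection.trans U, ?_, fun y hy => ?_⟩
  · have hcomp : (((ℝ ∙ x)ᗮ.reflection.trans U).toLinearEquiv : E →ₗ[ℝ] E) =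
        (U.toLinearEquiv : E →ₗ[ℝ] E) ∘ₗ ((ℝ ∙ x)ᗮ.reflection.toLinearEquiv : E →ₗ[ℝ] E) := rfl
    rw [hcomp, LinearMap.det_comp, hdet, det_reflection_orthogonal_span_singleton hx]
    norm_num
  · have hyx : y ∈ (ℝ ∙ x)ᗮ :=
      Submodule.mem_orthogonal_singleton_iff_inner_left.2 (hxK y hy)
    rw [LinearIsometryEquiv.trans_apply, Submodule.reflection_mem_subspace_eq_self hyx]

variable {ι : Type*} {v w : ι → E}

lemma exists_linearIsometryEquiv_apply_eq (hv : Orthonormal ℝ v) (hw : Orthonormal ℝ w) :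
    ∃ U : E ≃ₗᵢ[ℝ] E, ∀ i, U (v i) = w i := by
  let b := Module.Basis.span hv.linearIndependent
  have hb : ∀ i, b i = ⟨v i, Submodule.subset_span ⟨i, rfl⟩⟩ :=
    Module.Basis.span_apply hv.linearIndependent
  have hb_on : Orthonormal ℝ b := by
    rw [show (b : ι → _) = _ from funext hb]
    exact orthonormal_span hv
  have hbw : b.constr ℝ w ∘ b = w := funext (b.constr_basis ℝ w)
  let f := (b.constr ℝ w).isometryOfOrthonormal hb_on (by rwa [hbw])
  refine ⟨f.extend.toLinearIsometryEquiv rfl, fun i => ?_⟩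
  have hfb : f.extend (b i) = f (b i) := f.extend_apply (b i)
  rw [hb] at hfb
  exact hfb.trans ((congrArg f (hb i)).symm.trans (congrFun hbw i))

lemma exists_rotation_apply_eq [Fintype ι] (hcard : Fintype.card ι < Module.finrank ℝ E)
    (hv : Orthonormal ℝ v) (hw : Orthonormal ℝ w) :
    ∃ U : E ≃ₗᵢ[ℝ] E,
      LinearMap.det (U.toLinearEquiv : E →ₗ[ℝ] E) = 1 ∧ ∀ i, U (v i) = w i := by
  obtain ⟨U, hU⟩ := exists_linearIsometryEquiv_apply_eq hv hw
  have hspan : Submodule.span ℝ (Set.range v) ≠ ⊤ := fun h => by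
    have := finrank_range_le_card (R := ℝ) v
    rw [Set.finrank, h, finrank_top] at this
    omega
  obtain ⟨V, hV, hVU⟩ := exists_det_eq_one_eqOn U hspan
  exact ⟨V, hV, fun i => (hVU (Submodule.subset_span ⟨i, rfl⟩)).trans (hU i)⟩

lemma exists_rotation_of_inner_eq_zero (hE : 2 < Module.finrank ℝ E) {p q u w : E}
    (hp : p ≠ 0) (hq : q ≠ 0) (hpq : inner ℝ p q = 0) (huw : inner ℝ u w = 0)
    (hu : ‖u‖ = ‖p‖) (hw : ‖w‖ = ‖q‖) :
    ∃ U : E ≃ₗᵢ[ℝ] E,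
      LinearMap.det (U.toLinearEquiv : E →ₗ[ℝ] E) = 1 ∧ U p = u ∧ U q = w := by
  have hp' : ‖p‖ ≠ 0 := norm_ne_zero_iff.2 hp
  have hq' : ‖q‖ ≠ 0 := norm_ne_zero_iff.2 hq
  have huw_on := orthonormal_normalize_pair (norm_ne_zero_iff.1 (hu ▸ hp'))
    (norm_ne_zero_iff.1 (hw ▸ hq')) huw
  obtain ⟨U, hdet, hU⟩ := exists_rotation_apply_eq (by simpa using hE)
    (orthonormal_normalize_pair hp hq hpq) huw_on
  have h₀ : U (‖p‖⁻¹ • p) = ‖p‖⁻¹ • u := by simpa [hu] using hU 0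
  have h₁ : U (‖q‖⁻¹ • q) = ‖q‖⁻¹ • w := by simpa [hw] using hU 1
  rw [map_smul] at h₀ h₁
  exact ⟨U, hdet, smul_right_injective E (inv_ne_zero hp') h₀,
    smul_right_injective E (inv_ne_zero hq') h₁⟩

end Rotations

section Coordinates

/-- The standard inclusion `incl k d` as a linear isometry, for `k ≤ d`. -/
def inclIsometry {k d : ℕ} (h : k ≤ d) :
    EuclideanSpace ℝ (Fin k) →ₗᵢ[ℝ] EuclideanSpace ℝ (Fin d) :=
  LinearMap.isometryOfInner
    { toFun := incl k d
      map_add' := fun p q => by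
        ext i
        by_cases hi : (i : ℕ) < k <;> simp [incl, hi]
      map_smul' := fun c p => by
        ext i
        by_cases hi : (i : ℕ) < k <;> simp [incl, hi] }
    (fun p q => by
      obtain ⟨e, rfl⟩ := Nat.exists_eq_add_of_le h
      simp [PiLp.inner_apply, incl, Fin.sum_univ_add])

lemma isIsometricCopy_rectangle {d : ℕ} (hd : 3 ≤ d) {v₁ v₂ : EuclideanSpace ℝ (Fin 2)}
    (hv₁ : v₁ ≠ 0) (hv₂ : v₂ ≠ 0) (hv : inner ℝ v₁ v₂ = 0) (lam : ℝ)
    (x : EuclideanSpace ℝ (Fin d)) {u w : EuclideanSpace ℝ (Fin d)}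
    (hu : ‖u‖ = ‖v₁‖) (hw : ‖w‖ = ‖v₂‖) (huw : inner ℝ u w = 0) :
    IsIsometricCopy lam (rectangle v₁ v₂)
      {x, x + lam • u, x + lam • w, x + lam • u + lam • w} := by
  let J := inclIsometry (show 2 ≤ d by omega)
  obtain ⟨U, hdet, hU₁, hU₂⟩ := exists_rotation_of_inner_eq_zero (p := J v₁) (q := J v₂)
    (by rwa [finrank_euclideanSpace_fin]) ((map_ne_zero_iff J J.injective).2 hv₁)
    ((map_ne_zero_iff J J.injective).2 hv₂)
    (by rw [J.inner_map_map, hv]) huw (by rw [hu, J.norm_map]) (by rw [hw, J.norm_map])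
  refine ⟨x, U, hdet, ?_⟩
  change _ = (fun p => x + lam • U (J p)) '' rectangle v₁ v₂
  simp only [rectangle, Set.image_insert_eq, Set.image_singleton, map_zero, map_add, hU₁, hU₂,
    smul_zero, add_zero, smul_add, add_assoc]

variable {d₁ d₂ d : ℕ} (h : d₁ + d₂ = d)

lemma pair_add (x x' : EuclideanSpace ℝ (Fin d₁)) (y y' : EuclideanSpace ℝ (Fin d₂)) :
    pair h (x + x') (y + y') = pair h x y + pair h x' y' := by
  subst h
  ext i
  refine Fin.addCases (fun i => ?_) (fun i => ?_) i <;> simp [pair]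

lemma pair_smul (c : ℝ) (x : EuclideanSpace ℝ (Fin d₁)) (y : EuclideanSpace ℝ (Fin d₂)) :
    pair h (c • x) (c • y) = c • pair h x y := by
  subst h
  ext i
  refine Fin.addCases (fun i => ?_) (fun i => ?_) i <;> simp [pair]

lemma inner_pair (x x' : EuclideanSpace ℝ (Fin d₁)) (y y' : EuclideanSpace ℝ (Fin d₂)) :
    inner ℝ (pair h x y) (pair h x' y') = inner ℝ x x' + inner ℝ y y' := by
  subst h
  simp [PiLp.inner_apply, pair, Fin.sum_univ_add]

lemma exists_eq_pair (v : EuclideanSpace ℝ (Fin d)) : ∃ x y, v = pair h x y := by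
  subst h
  refine ⟨WithLp.toLp 2 fun i => v (Fin.castAdd d₂ i), WithLp.toLp 2 fun i => v (Fin.natAdd d₁ i),
    ?_⟩
  ext i
  refine Fin.addCases (fun i => ?_) (fun i => ?_) i <;> simp [pair]

/-- The inclusion `x ↦ (x, 0)` of the first factor of a splitting of coordinates. -/
def pairLeft : EuclideanSpace ℝ (Fin d₁) →ₗᵢ[ℝ] EuclideanSpace ℝ (Fin d) :=
  LinearMap.isometryOfInner
    { toFun := fun x => pair h x 0
      map_add' := fun x x' => by rw [← pair_add, add_zero]
      map_smul' := fun c x => by rw [RingHom.id_apply, ← pair_smul, smul_zero] }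
    (fun x x' => (inner_pair h x x' 0 0).trans (by rw [inner_zero_left, add_zero]))

/-- The inclusion `y ↦ (0, y)` of the second factor of a splitting of coordinates. -/
def pairRight : EuclideanSpace ℝ (Fin d₂) →ₗᵢ[ℝ] EuclideanSpace ℝ (Fin d) :=
  LinearMap.isometryOfInner
    { toFun := fun y => pair h 0 y
      map_add' := fun y y' => by rw [← pair_add, add_zero]
      map_smul' := fun c y => by rw [RingHom.id_apply, ← pair_smul, smul_zero] }
    (fun y y' => (inner_pair h 0 0 y y').trans (by rw [inner_zero_left, zero_add]))

lemma pair_add_pairLeft (x p : EuclideanSpace ℝ (Fin d₁)) (y : EuclideanSpace ℝ (Fin d₂)) :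
    pair h x y + pairLeft h p = pair h (x + p) y := by
  rw [← add_zero y, pair_add, add_zero]
  rfl

lemma pair_add_pairRight (x : EuclideanSpace ℝ (Fin d₁)) (y q : EuclideanSpace ℝ (Fin d₂)) :
    pair h x y + pairRight h q = pair h x (y + q) := by
  rw [← add_zero x, pair_add, add_zero]
  rfl

lemma inner_pairLeft_pairRight (x : EuclideanSpace ℝ (Fin d₁)) (y : EuclideanSpace ℝ (Fin d₂)) :
    inner ℝ (pairLeft h x) (pairRight h y) = 0 :=
  (inner_pair h x 0 0 y).trans (by rw [inner_zero_left, inner_zero_right, add_zero])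

/-- The complex plane, where `circleLaw` lives, as the plane of the first two coordinates. -/
def planeMap {k : ℕ} (hk : 2 ≤ k) : ℂ →ₗᵢ[ℝ] EuclideanSpace ℝ (Fin k) :=
  (inclIsometry hk).comp Complex.orthonormalBasisOneI.repr.toLinearIsometry

end Coordinates

theorem eventually_exists_rectangle_of_splitting {d : ℕ} {v₁ v₂ : EuclideanSpace ℝ (Fin 2)}
    (hv₁ : v₁ ≠ 0) (hv₂ : v₂ ≠ 0) (hv : inner ℝ v₁ v₂ = 0)
    {A : Set (EuclideanSpace ℝ (Fin d))} (hA : NullMeasurableSet A volume)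
    (hpos : 0 < upperBanachDensity A)
    {d₁ d₂ : ℕ} (h : d₁ + d₂ = d) (hd₁ : 2 ≤ d₁) (hd₂ : 2 ≤ d₂) :
    ∀ᶠ lam : ℝ in atTop,
      ∃ (x x' : EuclideanSpace ℝ (Fin d₁)) (y y' : EuclideanSpace ℝ (Fin d₂)),
        ‖x - x'‖ = lam * ‖v₁‖ ∧ ‖y - y'‖ = lam * ‖v₂‖ ∧
        ({pair h x y, pair h x' y, pair h x y', pair h x' y'} :
          Set (EuclideanSpace ℝ (Fin d))) ⊆ A ∧
        IsIsometricCopy lam (rectangle v₁ v₂)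
          {pair h x y, pair h x' y, pair h x y', pair h x' y'} := by
  let P₁ : ℂ →L[ℝ] EuclideanSpace ℝ (Fin d₁) := ‖v₁‖ • (planeMap hd₁).toContinuousLinearMap
  let P₂ : ℂ →L[ℝ] EuclideanSpace ℝ (Fin d₂) := ‖v₂‖ • (planeMap hd₂).toContinuousLinearMap
  have hP₁ : ∀ z : ℂ, ‖z‖ = 1 → ‖P₁ z‖ = ‖v₁‖ := fun z hz => by simp [P₁, norm_smul, hz]
  have hP₂ : ∀ w : ℂ, ‖w‖ = 1 → ‖P₂ w‖ = ‖v₂‖ := fun w hw => by simp [P₂, norm_smul, hw]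
  filter_upwards [eventually_exists_parallelogram hA hpos tendsto_charFun_circleLaw
    tendsto_charFun_circleLaw ae_norm_eq_one_circleLaw ae_norm_eq_one_circleLaw
    ((pairLeft h).toContinuousLinearMap.comp P₁) ((pairRight h).toContinuousLinearMap.comp P₂),
    eventually_ge_atTop 0] with lam ⟨v, z, hz, w, hw, hmem⟩ hlam
  obtain ⟨x, y, rfl⟩ := exists_eq_pair h v
  have hcopy := isIsometricCopy_rectangle (by omega) hv₁ hv₂ hv lam (pair h x y)
    (((pairLeft h).norm_map _).trans (hP₁ z hz)) (((pairRight h).norm_map _).trans (hP₂ w hw))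
    (inner_pairLeft_pairRight h (P₁ z) (P₂ w))
  simp only [ContinuousLinearMap.comp_apply, LinearIsometry.coe_toContinuousLinearMap] at hmem
  simp only [← (pairLeft h).map_smul, ← (pairRight h).map_smul, pair_add_pairLeft,
    pair_add_pairRight] at hmem hcopy
  refine ⟨x, x + lam • P₁ z, y, y + lam • P₂ w, ?_, ?_, ?_, hcopy⟩
  · rw [sub_add_cancel_left, norm_neg, norm_smul, Real.norm_of_nonneg hlam, hP₁ z hz]
  · rw [sub_add_cancel_left, norm_neg, norm_smul, Real.norm_of_nonneg hlam, hP₂ w hw]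
  · simpa only [Set.insert_subset_iff, Set.singleton_subset_iff] using hmem

end RectBanach

end

theorem mainTheorem1 (d : ℕ) (hd : 4 ≤ d)
    (v₁ v₂ : EuclideanSpace ℝ (Fin 2)) (hv₁ : v₁ ≠ 0) (hv₂ : v₂ ≠ 0)
    (hv : inner ℝ v₁ v₂ = 0)
    (A : Set (EuclideanSpace ℝ (Fin d))) (hA : NullMeasurableSet A volume)
    (hpos : 0 < RectBanach.upperBanachDensity A) :
    ∃ lam₀ : ℝ, 0 < lam₀ ∧ ∀ lam : ℝ, lam₀ ≤ lam →
      (∃ S : Set (EuclideanSpace ℝ (Fin d)), S ⊆ A ∧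
        RectBanach.IsIsometricCopy lam (RectBanach.rectangle v₁ v₂) S) ∧
      ∀ (d₁ d₂ : ℕ) (h : d₁ + d₂ = d), 2 ≤ d₁ → 2 ≤ d₂ →
        ∃ (x x' : EuclideanSpace ℝ (Fin d₁)) (y y' : EuclideanSpace ℝ (Fin d₂)),
          ‖x - x'‖ = lam * ‖v₁‖ ∧ ‖y - y'‖ = lam * ‖v₂‖ ∧
          ({RectBanach.pair h x y, RectBanach.pair h x' y, RectBanach.pair h x y',
            RectBanach.pair h x' y'} : Set (EuclideanSpace ℝ (Fin d))) ⊆ A ∧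
          RectBanach.IsIsometricCopy lam (RectBanach.rectangle v₁ v₂)
            {RectBanach.pair h x y, RectBanach.pair h x' y, RectBanach.pair h x y',
              RectBanach.pair h x' y'} := by
  have hfin : Finite {p : ℕ × ℕ // p.1 + p.2 = d ∧ 2 ≤ p.1 ∧ 2 ≤ p.2} :=
    (Finset.HasAntidiagonal.antidiagonal d).finite_toSet.subset fun p hp =>
      Finset.HasAntidiagonal.mem_antidiagonal.2 hp.1
  have hsplit := fun p : {p : ℕ × ℕ // p.1 + p.2 = d ∧ 2 ≤ p.1 ∧ 2 ≤ p.2} =>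
    RectBanach.eventually_exists_rectangle_of_splitting hv₁ hv₂ hv hA hpos
      p.2.1 p.2.2.1 p.2.2.2
  obtain ⟨lam₀, hlam₀⟩ := eventually_atTop.1 (eventually_all.2 hsplit)
  refine ⟨max lam₀ 1, by positivity, fun lam hlam => ?_⟩
  have hall := fun (d₁ d₂ : ℕ) (h : d₁ + d₂ = d) (hd₁ : 2 ≤ d₁) (hd₂ : 2 ≤ d₂) =>
    hlam₀ lam ((le_max_left _ _).trans hlam) ⟨(d₁, d₂), h, hd₁, hd₂⟩
  obtain ⟨x, x', y, y', -, -, hsub, hcopy⟩ := hall 2 (d - 2) (by omega) le_rfl (by omega)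
  exact ⟨⟨_, hsub, hcopy⟩, hall⟩
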